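/- **Setting.** Fix a database schema (relation names of positive arity, every attribute typed by one of two disjoint infinite domains: the rationals, or uninterpreted constants) and a finite set $F$ of denial constraints, i.e. sentences $\forall\bar x.\,\neg[R_1(\bar x_1)\wedge\dots\wedge R_n(\bar x_n)\wedge\varphi(\bar x)]$ with $n>0$, $\bar x_1\cup\dots\cup\bar x_n=\bar x$, and $\varphi$ quantifier-free using only $=,\neq$ (on both domains) and $<,\le,>,\ge$ (on rationals). An instance $I$ is a finite set of facts $R(t)$. A repair of $I$ is a maximal subset of $I$ consistent with $F$. A conflict in $I$ is a set of facts $\{R_1(t_1),\dots,R_n(t_n)\}\subseteq I$ such that for some constraint of $F$ as above a substitution $\rho$ satisfies $\varphi(\rho(\bar x))$ and $\rho(\bar x_i)=t_i$ for all $i$; two facts of $I$ are neighbors if some conflict in $I$ contains both. A priority $\succ$ of $I$ is an acyclic binary relation on $I$ relating only neighbors; it is total if no other priority of $I$ extends it. A repair $I'$ of $I$ is *Pareto optimal* w.r.t. $\succ$ if there are no nonempty $X\subseteq I'$ and nonempty $Y\subseteq I\setminus I'$ such that $y\succ x$ for all $x\in X$, $y\in Y$, and $(I'\setminus X)\cup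 Y$ is consistent. It is *globally optimal* w.r.t. $\succ$ if there are no nonempty $X\subseteq I'$ and $Y\subseteq I\setminus I'$ such that every $x\in X$ has some $y\in Y$ with $y\succ x$, and $(I'\setminus X)\cup Y$ is consistent. It is *common optimal* w.r.t. $\succ$ if it is globally optimal w.r.t. some total priority extending $\succ$. **Algorithms.** (A) *Constructing a repair:* start with $I^o=I$, $J=\varnothing$; while $I^o\ne\varnothing$, choose any $p\in I^o$, remove it from $I^o$, and add it to $J$ if $J\cup\{p\}$ is consistent with $F$; return $J$. (B) *Constructing a common optimal repair:* the same, except that the loop runs while, and $p$ is chosen in, the set $\omega_\succ(I^o)=\{p\in I^o : \nexists q\in I^o.\ q\succ p\}$. (C) *Constructing a Pareto optimal repair:* construct a repair $I'$ by (A); if $I'$ is Pareto optimal w.r.t. $\succ$ (tested by checking that there is no $y\in I\setminus I'$ such that every conflict in $I'\cup\{y\}$ contains some $x$ with $y\succ x$), return $I'$; otherwise return a common optimal repair constructed by (B). **Proposition.** Algorithm (C) is a sound and complete algorithm constructing Pareto optimal repairs, and it works in polynomial time: there is a polynomial $p$, depending only on the schema and $F$, such that for every instance $I$ and every priority $\succ$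 of $I$, with total input size $s$, every run of (C) on $(I,\succ)$, whatever choices are made, halts within $p(s)$ steps, and the instances returned by the runs are exactly the Pareto optimal repairs of $I$ w.r.t. $F$ and $\succ$. Within the same time bound, the runs of (A) produce exactly the repairs of $I$, the test in (C) decides Pareto optimality of repairs of $I$, and the runs of (B) produce exactly the common optimal repairs of $I$ w.r.t. $F$ and $\succ$. -/

import Mathlib

/-! ## Relational databases -/

/-- The two domains: rationals and uninterpreted constants. -/
inductive Domain where
  | num
  | sym

/-- Constants. Uninterpreted constants are identified with their names. -/
inductive Constant where
  | num (q : ℚ)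
  | sym (s : String)

/-- The domain a constant belongs to. -/
def Constant.domain : Constant → Domain
  | .num _ => .num
  | .sym _ => .sym

/-- Length of the notation of a constant (binary numerator and denominator, resp. the name). -/
def Constant.size : Constant → ℕ
  | .num q => 1 + Nat.size q.num.natAbs + Nat.size q.den
  | .sym s => 1 + s.length

/-- A schema: relation names of positive arity, every attribute being typed by a domain.
`signature R` lists the domains of the attributes of `R`. -/
structure Schema where
  Rel : Type
  signature : Rel → List Domain
  arity_pos : ∀ R, signature R ≠ []

/-- A fact `R(t)`. -/
structure DBFact (S : Schema) where
  rel : S.Rel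
  args : List Constant
  typed : args.map Constant.domain = S.signature rel

noncomputable instance (S : Schema) : DecidableEq (DBFact S) := Classical.decEq _

/-- Size of a fact; the relation name counts as one symbol. -/
def DBFact.size {S : Schema} (f : DBFact S) : ℕ := 1 + (f.args.map Constant.size).sum

/-- Instances, viewed as finite sets of facts. -/
abbrev DBInstance (S : Schema) := Finset (DBFact S)

/-! ## Denial constraints -/

/-- Built-in relation symbols. -/
inductive BuiltIn where
  | eq | ne | lt | le | gt | ge

/-- Natural interpretation of the built-in symbols: equality and inequality on all constants,
the order symbols on rationals only. -/
def BuiltIn.Holds : BuiltIn → Constant → Constant → Prop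
  | .eq, a, b => a = b
  | .ne, a, b => a ≠ b
  | .lt, .num a, .num b => a < b
  | .le, .num a, .num b => a ≤ b
  | .gt, .num a, .num b => a > b
  | .ge, .num a, .num b => a ≥ b
  | _, _, _ => False

/-- Whether a built-in symbol is available on a domain. -/
def BuiltIn.AllowedOn : BuiltIn → Domain → Prop
  | .eq, _ => True
  | .ne, _ => True
  | _, d => d = .num

/-- Terms over `n` variables. -/
inductive DBTerm (n : ℕ) where
  | var (v : Fin n)
  | const (c : Constant)

def DBTerm.value {n : ℕ} (ρ : Fin n → Constant) : DBTerm n → Constant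
  | .var v => ρ v
  | .const c => c

def DBTerm.domain {n : ℕ} (dom : Fin n → Domain) : DBTerm n → Domain
  | .var v => dom v
  | .const c => c.domain

/-- Quantifier-free formulas over `n` variables that use built-in relation symbols only. -/
inductive QFFormula (n : ℕ) where
  | verum
  | atom (op : BuiltIn) (s t : DBTerm n)
  | neg (φ : QFFormula n)
  | and (φ ψ : QFFormula n)
  | or (φ ψ : QFFormula n)

def QFFormula.Holds {n : ℕ} (ρ : Fin n → Constant) : QFFormula n → Prop
  | .verum => True
  | .atom op s t => op.Holds (s.value ρ) (t.value ρ)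
  | .neg φ => ¬ φ.Holds ρ
  | .and φ ψ => φ.Holds ρ ∧ ψ.Holds ρ
  | .or φ ψ => φ.Holds ρ ∨ ψ.Holds ρ

def QFFormula.WellTyped {n : ℕ} (dom : Fin n → Domain) : QFFormula n → Prop
  | .verum => True
  | .atom op s t => s.domain dom = t.domain dom ∧ op.AllowedOn (s.domain dom)
  | .neg φ => φ.WellTyped dom
  | .and φ ψ => φ.WellTyped dom ∧ ψ.WellTyped dom
  | .or φ ψ => φ.WellTyped dom ∧ ψ.WellTyped dom

/-- An atom `R(x̄)` over `n` variables. -/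
structure RelAtom (S : Schema) (n : ℕ) where
  rel : S.Rel
  vars : List (Fin n)

/-- The substitution `ρ` turns the atom into the fact `f`. -/
def RelAtom.Matches {S : Schema} {n : ℕ} (ρ : Fin n → Constant) (a : RelAtom S n) (f : DBFact S) :
    Prop :=
  f.rel = a.rel ∧ f.args = a.vars.map ρ

/-- A denial constraint `∀ x̄. ¬ [R₁(x̄₁) ∧ … ∧ Rₘ(x̄ₘ) ∧ φ(x̄)]` with `m > 0` and
`x̄₁ ∪ … ∪ x̄ₘ = x̄`, well-typed. -/
structure DenialConstraint (S : Schema) where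
  nvars : ℕ
  dom : Fin nvars → Domain
  atoms : List (RelAtom S nvars)
  cond : QFFormula nvars
  atoms_ne_nil : atoms ≠ []
  covers : ∀ v, ∃ a ∈ atoms, v ∈ a.vars
  atoms_typed : ∀ a ∈ atoms, a.vars.map dom = S.signature a.rel
  cond_typed : cond.WellTyped dom

/-- Substitutions that respect the domains of the variables. -/
def DenialConstraint.Admissible {S : Schema} (c : DenialConstraint S)
    (ρ : Fin c.nvars → Constant) : Prop :=
  ∀ v, (ρ v).domain = c.dom v

/-- `I ⊨ c`. -/
def DenialConstraint.SatisfiedIn {S : Schema} (c : DenialConstraint S) (I : DBInstance S) : Prop :=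
  ∀ ρ, c.Admissible ρ → ¬ ((∀ a ∈ c.atoms, ∃ f ∈ I, a.Matches ρ f) ∧ c.cond.Holds ρ)

/-- `I` is consistent with the finite set `F` of denial constraints. -/
def Consistent {S : Schema} (F : List (DenialConstraint S)) (I : DBInstance S) : Prop :=
  ∀ c ∈ F, c.SatisfiedIn I

/-- `Rep(I, F)`: the maximal consistent subsets of `I`. -/
def Repairs {S : Schema} (F : List (DenialConstraint S)) (I : DBInstance S) : Set (DBInstance S) :=
  {I' | Maximal (fun J => J ⊆ I ∧ Consistent F J) I'}

/-- `C` is a conflict in `I` w.r.t. `F`. -/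
def IsConflict {S : Schema} (F : List (DenialConstraint S)) (I C : DBInstance S) : Prop :=
  C ⊆ I ∧ ∃ c ∈ F, ∃ ρ, c.Admissible ρ ∧ c.cond.Holds ρ ∧
    ∃ fs : List (DBFact S), List.Forall₂ (fun a f => a.Matches ρ f) c.atoms fs ∧ C = fs.toFinset

/-- Some conflict in `I` contains both facts. -/
def Neighbors {S : Schema} (F : List (DenialConstraint S)) (I : DBInstance S) (x y : DBFact S) : Prop :=
  ∃ C, IsConflict F I C ∧ x ∈ C ∧ y ∈ C

/-! ## Priorities and preferred repairs

`r x y` stands for `x ≻ y`. -/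

/-- Priorities of `I` w.r.t. `F`: acyclic relations that relate only neighboring facts of `I`. -/
structure IsPriority {S : Schema} (F : List (DenialConstraint S)) (I : DBInstance S)
    (r : DBFact S → DBFact S → Prop) : Prop where
  acyclic : ∀ x, ¬ Relation.TransGen r x x
  neighbors : ∀ x y, r x y → x ∈ I ∧ y ∈ I ∧ Neighbors F I x y

/-- Priorities that no other priority extends. -/
def IsTotalPriority {S : Schema} (F : List (DenialConstraint S)) (I : DBInstance S)
    (r : DBFact S → DBFact S → Prop) : Prop :=
  IsPriority F I r ∧ ∀ r' : DBFact S → DBFact S → Prop,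
    IsPriority F I r' → (∀ x y, r x y → r' x y) → r' = r

def ParetoOptimal {S : Schema} (F : List (DenialConstraint S)) (I : DBInstance S)
    (r : DBFact S → DBFact S → Prop) (I' : DBInstance S) : Prop :=
  I' ⊆ I ∧ ¬ ∃ X Y : DBInstance S, X.Nonempty ∧ X ⊆ I' ∧ Y.Nonempty ∧ Y ⊆ I \ I' ∧
    (∀ x ∈ X, ∀ y ∈ Y, r y x) ∧ Consistent F ((I' \ X) ∪ Y)

def GloballyOptimal {S : Schema} (F : List (DenialConstraint S)) (I : DBInstance S)
    (r : DBFact S → DBFact S → Prop) (I' : DBInstance S) : Prop :=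
  I' ⊆ I ∧ ¬ ∃ X Y : DBInstance S, X.Nonempty ∧ X ⊆ I' ∧ Y ⊆ I \ I' ∧
    (∀ x ∈ X, ∃ y ∈ Y, r y x) ∧ Consistent F ((I' \ X) ∪ Y)

def CommonOptimal {S : Schema} (F : List (DenialConstraint S)) (I : DBInstance S)
    (r : DBFact S → DBFact S → Prop) (I' : DBInstance S) : Prop :=
  ∃ r' : DBFact S → DBFact S → Prop, IsTotalPriority F I r' ∧ (∀ x y, r x y → r' x y) ∧
    GloballyOptimal F I r' I'

/-- The Pareto optimal repairs. -/
def ParetoRepairs {S : Schema} (F : List (DenialConstraint S)) (I : DBInstance S)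
    (r : DBFact S → DBFact S → Prop) : Set (DBInstance S) :=
  {I' | I' ∈ Repairs F I ∧ ParetoOptimal F I r I'}

/-- The common optimal repairs. -/
def CommonRepairs {S : Schema} (F : List (DenialConstraint S)) (I : DBInstance S)
    (r : DBFact S → DBFact S → Prop) : Set (DBInstance S) :=
  {I' | I' ∈ Repairs F I ∧ CommonOptimal F I r I'}

/-! ## A nondeterministic programming language with a step count

Programs are syntax trees over linked data (Booleans, constants, facts, pairs, lists), run by an
interpreter with a time budget. Variables are represented by parametric higher-order abstract
syntax: a program is given uniformly in `V`, so it can inspect data only by the instructions below,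
each of which is charged. -/

/-- Data types of the language. -/
inductive Ty where
  | bool
  | const
  | fact
  | prod (σ τ : Ty)
  | list (τ : Ty)

def Ty.denote (S : Schema) : Ty → Type
  | .bool => Bool
  | .const => Constant
  | .fact => DBFact S
  | .prod σ τ => σ.denote S × τ.denote S
  | .list τ => List (τ.denote S)

/-- Program expressions of type `τ` with variables taken from `V`. -/
inductive Prog (S : Schema) (V : Ty → Type) : Ty → Type where
  | var {τ : Ty} (x : V τ) : Prog S V τ
  | bind {σ τ : Ty} (e : Prog S V σ) (k : V σ → Prog S V τ) : Prog S V τ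
  | lit (b : Bool) : Prog S V .bool
  | ite {τ : Ty} (c : Prog S V .bool) (t e : Prog S V τ) : Prog S V τ
  | pair {σ τ : Ty} (a : Prog S V σ) (b : Prog S V τ) : Prog S V (.prod σ τ)
  | fst {σ τ : Ty} (p : Prog S V (.prod σ τ)) : Prog S V σ
  | snd {σ τ : Ty} (p : Prog S V (.prod σ τ)) : Prog S V τ
  | nil {τ : Ty} : Prog S V (.list τ)
  | cons {τ : Ty} (a : Prog S V τ) (l : Prog S V (.list τ)) : Prog S V (.list τ)
  | isNil {τ : Ty} (l : Prog S V (.list τ)) : Prog S V .bool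
  /-- `for x in l do acc := body x acc` -/
  | forIn {σ τ : Ty} (l : Prog S V (.list σ)) (init : Prog S V τ)
      (body : V σ → V τ → Prog S V τ) : Prog S V τ
  /-- `while cond state do state := body state` -/
  | whileDo {τ : Ty} (init : Prog S V τ) (cond : V τ → Prog S V .bool)
      (body : V τ → Prog S V τ) : Prog S V τ
  /-- nondeterministic choice of an element of a list -/
  | choose {τ : Ty} (l : Prog S V (.list τ)) : Prog S V τ
  | constant (c : Constant) : Prog S V .const
  /-- is the fact `f` a fact of the relation `R`? -/
  | relIs (R : S.Rel) (f : Prog S V .fact) : Prog S V .bool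
  /-- the `i`-th component of a fact (counted from `0`) -/
  | arg (i : ℕ) (f : Prog S V .fact) : Prog S V .const
  | cmp (op : BuiltIn) (a b : Prog S V .const) : Prog S V .bool
  | eqFact (f g : Prog S V .fact) : Prog S V .bool

/-- Nondeterministic computations with a clock: from a time budget to the set of outcomes, where
`some (a, k)` is a run that ends with value `a` and `k` unused steps, and `none` is a run that
exceeds the budget or gets stuck. -/
def Comp (α : Type) : Type := ℕ → Set (Option (α × ℕ))

namespace Comp

def ret {α : Type} (a : α) : Comp α := fun b => {some (a, b)}

def fail {α : Type} : Comp α := fun _ => {none}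

/-- Spend `k` steps, then continue as `m`. -/
def spend {α : Type} (k : ℕ) (m : Comp α) : Comp α := fun b => if b < k then {none} else m (b - k)

def andThen {α β : Type} (m : Comp α) (f : α → Comp β) : Comp β := fun b =>
  {o | (none ∈ m b ∧ o = none) ∨ ∃ a b', some (a, b') ∈ m b ∧ o ∈ f a b'}

/-- Pick any element of the list, in time `1 + length`; stuck on the empty list. -/
def choose {α : Type} (l : List α) : Comp α :=
  spend (1 + l.length) fun b => {o | (l = [] ∧ o = none) ∨ ∃ a ∈ l, o = some (a, b)}

/-- A for-loop; every iteration costs one step in addition to its body. -/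
def forLoop {α β : Type} (body : α → β → Comp β) : List α → β → Comp β
  | [], s => ret s
  | a :: l, s => spend 1 (andThen (body a s) (forLoop body l))

/-- The first `n` rounds of a while-loop; every round costs one step in addition to the condition
and the body. -/
def whileRounds {β : Type} (cond : β → Comp Bool) (body : β → Comp β) : ℕ → β → Comp β
  | 0, _ => fail
  | n + 1, s => spend 1 (andThen (cond s) fun t =>
      if t then andThen (body s) (whileRounds cond body n) else ret s)

/-- A while-loop. Every round costs at least one step, so with budget `b` the cut-off after `b + 1`
rounds affects only runs that have exceeded the budget anyway. -/
def whileLoop {β : Type} (cond : β → Comp Bool) (body : β → Comp β) (s : β) : Comp β :=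
  fun b => whileRounds cond body (b + 1) s b

/-- No run exceeds the budget `b` or gets stuck. -/
def HaltsWithin {α : Type} (m : Comp α) (b : ℕ) : Prop := none ∉ m b

/-- The results of the runs that end within the budget `b`. -/
def results {α : Type} (m : Comp α) (b : ℕ) : Set α := {a | ∃ k, some (a, k) ∈ m b}

end Comp

open Classical in
/-- The interpreter. Every instruction costs one step; comparisons cost more, according to the
length of the notation of what is compared. -/
noncomputable def Prog.eval {S : Schema} {τ : Ty} :
    Prog S (Ty.denote S) τ → Comp (Ty.denote S τ)
  | .var x => .spend 1 (.ret x)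
  | .bind e k => .spend 1 (e.eval.andThen fun x => (k x).eval)
  | .lit b => .spend 1 (.ret b)
  | .ite c t e => .spend 1 (c.eval.andThen fun x : Bool => if x then t.eval else e.eval)
  | .pair a b => .spend 1 (a.eval.andThen fun x => b.eval.andThen fun y => .ret (x, y))
  | .fst p => .spend 1 (p.eval.andThen fun x => .ret x.1)
  | .snd p => .spend 1 (p.eval.andThen fun x => .ret x.2)
  | .nil => .spend 1 (.ret [])
  | .cons a l => .spend 1 (a.eval.andThen fun x => l.eval.andThen fun y => .ret (List.cons x y))
  | .isNil l => .spend 1 (l.eval.andThen fun x => .ret (List.isEmpty x))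
  | .forIn l init body => .spend 1 (l.eval.andThen fun x => init.eval.andThen fun s =>
      Comp.forLoop (fun a t => (body a t).eval) x s)
  | .whileDo init cond body => .spend 1 (init.eval.andThen fun s =>
      Comp.whileLoop (fun t => (cond t).eval) (fun t => (body t).eval) s)
  | .choose l => .spend 1 (l.eval.andThen fun x => Comp.choose x)
  | .constant c => .spend 1 (.ret c)
  | .relIs R f => .spend 1 (f.eval.andThen fun x : DBFact S => .ret (decide (x.rel = R)))
  | .arg i f => .spend 1 (f.eval.andThen fun x : DBFact S => .ret (x.args.getD i (.num 0)))
  | .cmp op a b => .spend 1 (a.eval.andThen fun x : Constant => b.eval.andThen fun y : Constant =>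
      .spend ((x.size + y.size) ^ 2) (.ret (decide (op.Holds x y))))
  | .eqFact f g => .spend 1 (f.eval.andThen fun x : DBFact S => g.eval.andThen fun y : DBFact S =>
      .spend (x.size + y.size) (.ret (decide (x = y))))

/-! ## The algorithms -/

namespace Prog

variable {S : Schema} {V : Ty → Type}

def not (a : Prog S V .bool) : Prog S V .bool := ite a (lit false) (lit true)

def and (a b : Prog S V .bool) : Prog S V .bool := ite a b (lit false)

def or (a b : Prog S V .bool) : Prog S V .bool := ite a (lit true) b

/-- Conjunction and disjunction of a fixed list of tests. -/
def all : List (Prog S V .bool) → Prog S V .bool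
  | [] => lit true
  | a :: l => and a (all l)

def any : List (Prog S V .bool) → Prog S V .bool
  | [] => lit false
  | a :: l => or a (any l)

/-- Does some element of the list pass the test? -/
def existsIn {τ : Ty} (l : Prog S V (.list τ)) (test : V τ → Prog S V .bool) : Prog S V .bool :=
  forIn l (lit false) fun x found => ite (var found) (lit true) (test x)

/-- The sublist of the elements that pass the test (in reverse order). -/
def filter {τ : Ty} (l : Prog S V (.list τ)) (test : V τ → Prog S V .bool) : Prog S V (.list τ) :=
  forIn l nil fun x acc => ite (test x) (cons (var x) (var acc)) (var acc)

/-- `x ∈ l` -/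
def mem (x : V .fact) (l : V (.list .fact)) : Prog S V .bool :=
  existsIn (var l) fun y => eqFact (var y) (var x)

/-- `l \ {x}` -/
def remove (x : V .fact) (l : V (.list .fact)) : Prog S V (.list .fact) :=
  filter (var l) fun y => not (eqFact (var y) (var x))

/-- `x ≻ y`, where the priority is given by its list of pairs -/
def dominates (prio : V (.list (.prod .fact .fact))) (x y : V .fact) : Prog S V .bool :=
  existsIn (var prio) fun p => and (eqFact (fst (var p)) (var x)) (eqFact (snd (var p)) (var y))

/-- The occurrences of variables in the atom, each with the component of `f` that it stands for. -/
def occurrences {n : ℕ} (a : RelAtom S n) (f : V .fact) : List (Fin n × Prog S V .const) :=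
  a.vars.zipIdx.map fun v => (v.1, arg v.2 (var f))

/-- The value of a term, where `occ` tells where the values of the variables are found. -/
def term {n : ℕ} (occ : List (Fin n × Prog S V .const)) : DBTerm n → Prog S V .const
  | .var v => (occ.lookup v).getD (constant (.num 0))
  | .const c => constant c

/-- Test of a quantifier-free formula. -/
def formula {n : ℕ} (occ : List (Fin n × Prog S V .const)) : QFFormula n → Prog S V .bool
  | .verum => lit true
  | .atom op s t => cmp op (term occ s) (term occ t)
  | .neg φ => not (formula occ φ)
  | .and φ ψ => and (formula occ φ) (formula occ ψ)
  | .or φ ψ => or (formula occ φ) (formula occ ψ)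

/-- Is the sequence `fs` an instance of the atoms of `c` under one substitution satisfying the
condition of `c`? The relation names are compared, then the values found at any two occurrences of
the same variable, then the condition is evaluated. -/
def isInstance (c : DenialConstraint S) (fs : List (V .fact)) : Prog S V .bool :=
  let occ := (List.zipWith occurrences c.atoms fs).flatten
  and (all (List.zipWith (fun a f => relIs a.rel (var f)) c.atoms fs))
    (and (all (((occ ×ˢ occ).filter fun p => p.1.1 = p.2.1).map fun p => cmp .eq p.1.2 p.2.2))
      (formula occ c.cond))

/-- `n` nested loops over `l`: does some sequence of `n` elements pass the test? -/
def existsTuple (l : V (.list .fact)) :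
    ℕ → (List (V .fact) → Prog S V .bool) → Prog S V .bool
  | 0, test => test []
  | n + 1, test => existsIn (var l) fun f => existsTuple l n fun fs => test (f :: fs)

/-- Does some conflict in `l` pass the test? -/
def existsConflict (F : List (DenialConstraint S)) (l : V (.list .fact))
    (test : List (V .fact) → Prog S V .bool) : Prog S V .bool :=
  any (F.map fun c => existsTuple l c.atoms.length fun fs => and (isInstance c fs) (test fs))

/-- `l ⊨ F` -/
def consistent (F : List (DenialConstraint S)) (l : V (.list .fact)) : Prog S V .bool :=
  not (existsConflict F l fun _ => lit true)

/-- `if J ∪ {x} ⊨ F then J ∪ {x} else J` -/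
def addIfConsistent (F : List (DenialConstraint S)) (x : V .fact) (J : V (.list .fact)) :
    Prog S V (.list .fact) :=
  bind (cons (var x) (var J)) fun K => ite (consistent F K) (var K) (var J)

/-- Construction of a repair: start with `(Iᵒ, J) = (I, ∅)`; while `Iᵒ` is nonempty, choose
`x ∈ Iᵒ`, remove it from `Iᵒ`, and add it to `J` if `J ∪ {x} ⊨ F`; return `J`. -/
def constructRepair (F : List (DenialConstraint S)) (I : V (.list .fact)) :
    Prog S V (.list .fact) :=
  snd (whileDo (pair (var I) nil)
    (fun s => not (isNil (fst (var s))))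
    (fun s => bind (fst (var s)) fun Io => bind (snd (var s)) fun J =>
      bind (choose (var Io)) fun x =>
        pair (remove x Io) (addIfConsistent F x J)))

/-- The winnow operator: the facts of `l` that no fact of `l` dominates. -/
def winnow (prio : V (.list (.prod .fact .fact))) (l : V (.list .fact)) : Prog S V (.list .fact) :=
  filter (var l) fun x => not (existsIn (var l) fun y => dominates prio y x)

/-- Construction of a common optimal repair: as `constructRepair`, but the choice is made among the
undominated facts of `Iᵒ`, as long as there are any. -/
def constructCommonOptimalRepair (F : List (DenialConstraint S)) (I : V (.list .fact))
    (prio : V (.list (.prod .fact .fact))) : Prog S V (.list .fact) :=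
  snd (whileDo (pair (var I) nil)
    (fun s => bind (fst (var s)) fun Io => not (isNil (winnow prio Io)))
    (fun s => bind (fst (var s)) fun Io => bind (snd (var s)) fun J =>
      bind (choose (winnow prio Io)) fun x =>
        pair (remove x Io) (addIfConsistent F x J)))

/-- Test of Pareto optimality of a repair `I'` of `I`: there is no `y ∈ I \ I'` such that every
conflict in `I' ∪ {y}` contains a fact dominated by `y`. -/
def isParetoOptimal (F : List (DenialConstraint S)) (I : V (.list .fact))
    (prio : V (.list (.prod .fact .fact))) (I' : V (.list .fact)) : Prog S V .bool :=
  not (existsIn (var I) fun y => and (not (mem y I'))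
    (bind (cons (var y) (var I')) fun K =>
      not (existsConflict F K fun fs => not (any (fs.map fun x => dominates prio y x)))))

/-- Construction of a Pareto optimal repair: construct a repair, return it if it is Pareto optimal,
and otherwise return a common optimal repair. -/
def constructParetoOptimalRepair (F : List (DenialConstraint S)) (I : V (.list .fact))
    (prio : V (.list (.prod .fact .fact))) : Prog S V (.list .fact) :=
  bind (constructRepair F I) fun I' =>
    ite (isParetoOptimal F I prio I') (var I') (constructCommonOptimalRepair F I prio)

end Prog

/-- Size of the input: an instance and a priority, given by lists of facts and of pairs of facts. -/
def inputSize {S : Schema} (l : List (DBFact S)) (p : List (DBFact S × DBFact S)) : ℕ :=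
  (l.map DBFact.size).sum + (p.map fun q => q.1.size + q.2.size).sum

/-- Every run of the program halts within `b` steps, and the instances (listed by the results) that
the runs produce are exactly those in `A`. -/
def ProducesExactly {S : Schema} (e : Prog S (Ty.denote S) (.list .fact)) (b : ℕ)
    (A : Set (DBInstance S)) : Prop :=
  e.eval.HaltsWithin b ∧
    {J : DBInstance S | ∃ l : List (DBFact S), l ∈ e.eval.results b ∧ l.toFinset = J} = A

/-!
A run of either repair construction considers the facts of `I` one after another and accepts a fact
when this keeps the set of accepted facts consistent. Its result is therefore the greedy repair of
an enumeration of `I`; for the common optimal construction, these are the enumerations in which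
every fact is undominated among itself and the facts listed after it. Listing a repair first, and
the rest of `I` after it, shows that every repair is greedy. A total priority orients every pair of
distinct neighbors, so a repair that is globally optimal with respect to it is greedy for every
enumeration compatible with it; conversely an enumeration compatible with `≻` orients all pairs of
neighbors that `≻` leaves open, giving a total priority for which its greedy repair is optimal.

An improvement in the Pareto sense can be taken with `Y = {y}` and `X` the facts dominated by `y`,
which yields the test used by the algorithm. As common optimal repairs are Pareto optimal, both
branches return Pareto optimal repairs, and every such repair is returned by the run that
constructs it first.

The running time is bounded compositionally: a bound on the cost of each subprogram, uniform over
the values of its free variables, is polynomial in the size of the input, and each loop makes at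
most polynomially many rounds. A run of a greedy loop never increases the total size of its state,
so the bounds on the rounds are uniform in the state.
-/

/-! ## Choice sequences -/

section ChoiceSequence

variable {α : Type*} {r r' : α → α → Prop} {s : Finset α} {l : List α} {x : α}

theorem not_transGen_self_of_lt {f : α → ℕ} (hf : ∀ x y, r x y → f x < f y) (x : α) :
    ¬ Relation.TransGen r x x := fun h => by
  have hlt : Relation.TransGen (· < ·) (f x) (f x) := h.lift f hf
  rw [Relation.transGen_eq_self] at hlt
  exact lt_irrefl _ hlt

theorem exists_mem_forall_not_transGen (hr : ∀ x, ¬ Relation.TransGen r x x) (hs : s.Nonempty) :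
    ∃ x ∈ s, ∀ y ∈ s, ¬ Relation.TransGen r y x := by
  have : IsStrictOrder α (Relation.TransGen r) := { irrefl := hr, trans := fun _ _ _ => .trans }
  have hwf : (s : Set α).WellFoundedOn (Relation.TransGen r) := s.wellFoundedOn
  obtain ⟨x₀, hx₀⟩ := hs
  obtain ⟨⟨x, hx⟩, -, hmin⟩ := hwf.has_min Set.univ ⟨⟨x₀, hx₀⟩, trivial⟩
  exact ⟨x, hx, fun y hy => hmin ⟨y, hy⟩ trivial⟩

variable [DecidableEq α]

/-- The order in which the elements of `s` may be removed from it one at a time when only an element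
that no remaining element dominates can be chosen; `r x y` says that `x` dominates `y`. -/
structure IsChoiceSequence (r : α → α → Prop) (s : Finset α) (l : List α) : Prop where
  nodup : l.Nodup
  toFinset_eq : l.toFinset = s
  pairwise : l.Pairwise fun x y => ¬ r y x

theorem isChoiceSequence_nil : IsChoiceSequence r s [] ↔ s = ∅ :=
  ⟨fun h => h.toFinset_eq.symm, fun h => ⟨.nil, h.symm, .nil⟩⟩

theorem isChoiceSequence_cons (hr : ¬ r x x) :
    IsChoiceSequence r s (x :: l) ↔
      x ∈ s ∧ (∀ y ∈ s, ¬ r y x) ∧ IsChoiceSequence r (s.erase x) l := by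
  constructor
  · rintro ⟨hnodup, rfl, hpair⟩
    obtain ⟨hx, hnodup⟩ := List.nodup_cons.1 hnodup
    obtain ⟨hlast, hpair⟩ := List.pairwise_cons.1 hpair
    refine ⟨by simp, by simpa [hr] using hlast, hnodup, ?_, hpair⟩
    rw [List.toFinset_cons, Finset.erase_insert (by simpa using hx)]
  · rintro ⟨hx, hlast, hnodup, hl, hpair⟩
    have hmem : ∀ y, y ∈ l ↔ y ≠ x ∧ y ∈ s := fun y => by
      rw [← List.mem_toFinset, hl, Finset.mem_erase]
    refine ⟨List.nodup_cons.2 ⟨fun h => ((hmem x).1 h).1 rfl, hnodup⟩, ?_,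
      List.pairwise_cons.2 ⟨fun y hy => hlast y ((hmem y).1 hy).2, hpair⟩⟩
    rw [List.toFinset_cons, hl, Finset.insert_erase hx]

theorem IsChoiceSequence.mono (h : IsChoiceSequence r' s l) (hr : ∀ x y, r x y → r' x y) :
    IsChoiceSequence r s l :=
  ⟨h.nodup, h.toFinset_eq, h.pairwise.imp fun hyx => mt (hr _ _) hyx⟩

theorem exists_isChoiceSequence (hr : ∀ x, ¬ Relation.TransGen r x x) (s : Finset α) :
    ∃ l, IsChoiceSequence r s l := by
  induction s using Finset.strongInduction with
  | H s ih =>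
    rcases s.eq_empty_or_nonempty with rfl | hs
    · exact ⟨[], isChoiceSequence_nil.2 rfl⟩
    · obtain ⟨x, hx, hmin⟩ := exists_mem_forall_not_transGen hr hs
      obtain ⟨l, hl⟩ := ih (s.erase x) (Finset.erase_ssubset hx)
      exact ⟨x :: l, (isChoiceSequence_cons fun h => hr x (.single h)).2
        ⟨hx, fun y hy h => hmin y hy (.single h), hl⟩⟩

theorem IsChoiceSequence.not_rel_of_append {l₁ l₂ : List α} (h : IsChoiceSequence r s (l₁ ++ l₂))
    {y : α} (hx : x ∈ l₁) (hy : y ∈ l₂) : ¬ r y x :=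
  (List.pairwise_append.1 h.pairwise).2.2 x hx y hy

end ChoiceSequence

/-! ## Conflicts and neighbors -/

section Conflicts

variable {S : Schema} {F : List (DenialConstraint S)} {I J K C : DBInstance S} {x y : DBFact S}

theorem IsConflict.mono (h : IsConflict F J C) (hJK : J ⊆ K) : IsConflict F K C :=
  ⟨h.1.trans hJK, h.2⟩

theorem IsConflict.of_subset (h : IsConflict F K C) (hC : C ⊆ J) : IsConflict F J C :=
  ⟨hC, h.2⟩

theorem IsConflict.nonempty (h : IsConflict F K C) : C.Nonempty := by
  obtain ⟨-, c, -, ρ, -, -, fs, hfs, rfl⟩ := h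
  refine List.toFinset_nonempty_iff fs |>.2 ?_
  rintro rfl
  exact c.atoms_ne_nil (List.forall₂_nil_right_iff.1 hfs)

theorem consistent_iff_forall_not_isConflict : Consistent F K ↔ ∀ C, ¬ IsConflict F K C := by
  constructor
  · rintro h _ ⟨hCK, c, hc, ρ, hρ, hcond, fs, hfs, rfl⟩
    refine h c hc ρ hρ ⟨fun a ha => ?_, hcond⟩
    obtain ⟨i, hi, rfl⟩ := List.getElem_of_mem ha
    obtain ⟨hlen, hmatch⟩ := List.forall₂_iff_get.1 hfs
    exact ⟨fs[i], hCK (by simp), hmatch i hi (hlen ▸ hi)⟩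
  · rintro h c hc ρ hρ ⟨hmatch, hcond⟩
    have ⟨f₀, _⟩ := hmatch _ (List.head_mem c.atoms_ne_nil)
    have : Nonempty (DBFact S) := ⟨f₀⟩
    choose! f hfK hf using hmatch
    refine h (c.atoms.map f).toFinset ⟨?_, c, hc, ρ, hρ, hcond, _, ?_, rfl⟩
    · simpa [Finset.subset_iff] using hfK
    · exact List.forall₂_map_right_iff.2 (List.forall₂_same.2 hf)

theorem Consistent.mono (h : Consistent F K) (hJK : J ⊆ K) : Consistent F J :=
  consistent_iff_forall_not_isConflict.2 fun C hC =>
    consistent_iff_forall_not_isConflict.1 h C (hC.mono hJK)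

theorem consistent_empty : Consistent F (∅ : DBInstance S) :=
  consistent_iff_forall_not_isConflict.2 fun _ hC =>
    hC.nonempty.ne_empty (Finset.subset_empty.1 hC.1)

theorem mem_repairs_iff : K ∈ Repairs F I ↔
    K ⊆ I ∧ Consistent F K ∧ ∀ y ∈ I, y ∉ K → ¬ Consistent F (insert y K) := by
  constructor
  · rintro ⟨⟨hKI, hK⟩, hmax⟩
    refine ⟨hKI, hK, fun y hy hyK hc => hyK ?_⟩
    exact hmax ⟨Finset.insert_subset hy hKI, hc⟩ (Finset.subset_insert y K)
      (Finset.mem_insert_self y K)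
  · rintro ⟨hKI, hK, hmax⟩
    refine ⟨⟨hKI, hK⟩, fun L ⟨hLI, hL⟩ hKL y hy => ?_⟩
    by_contra hyK
    exact hmax y (hLI hy) hyK (hL.mono (Finset.insert_subset hy hKL))

theorem Neighbors.symm (h : Neighbors F I x y) : Neighbors F I y x := by
  obtain ⟨C, hC, hx, hy⟩ := h
  exact ⟨C, hC, hy, hx⟩

theorem Neighbors.left_mem (h : Neighbors F I x y) : x ∈ I := by
  obtain ⟨C, hC, hx, -⟩ := h
  exact hC.1 hx

open Classical in
theorem consistent_insert_of_consistent_insert_neighbors (hJ : Consistent F J)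
    (hJI : insert y J ⊆ I) (h : Consistent F (insert y (J.filter (Neighbors F I · y)))) :
    Consistent F (insert y J) := by
  refine consistent_iff_forall_not_isConflict.2 fun C hC => ?_
  by_cases hy : y ∈ C
  · refine consistent_iff_forall_not_isConflict.1 h C (hC.of_subset fun x hx => ?_)
    have hxy : Neighbors F I x y := ⟨C, hC.mono hJI, hx, hy⟩
    exact (Finset.mem_insert.1 (hC.1 hx)).elim (by simp +contextual)
      fun hxJ => Finset.mem_insert_of_mem (Finset.mem_filter.2 ⟨hxJ, hxy⟩)
  · exact consistent_iff_forall_not_isConflict.1 hJ C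
      (hC.of_subset ((Finset.subset_insert_iff_of_notMem hy).1 hC.1))

end Conflicts

/-! ## The greedy construction -/

section Greedy

variable {S : Schema} {F : List (DenialConstraint S)} {I J K : DBInstance S}
  {r : DBFact S → DBFact S → Prop} {l : List (DBFact S)} {x y : DBFact S}

open Classical in
/-- The instance obtained from `J` by adding the fact `x` unless this makes it inconsistent. -/
noncomputable def accept (F : List (DenialConstraint S)) (J : DBInstance S) (x : DBFact S) :
    DBInstance S :=
  if Consistent F (insert x J) then insert x J else J

/-- The instance that the greedy construction returns when it considers the facts in the order in
which `l` lists them. -/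
noncomputable def greedyRepair (F : List (DenialConstraint S)) (l : List (DBFact S)) :
    DBInstance S :=
  l.foldl (accept F) ∅

theorem subset_accept : J ⊆ accept F J x := by
  unfold accept
  split_ifs
  exacts [Finset.subset_insert x J, subset_rfl]

theorem accept_subset_insert : accept F J x ⊆ insert x J := by
  unfold accept
  split_ifs
  exacts [subset_rfl, Finset.subset_insert x J]

theorem Consistent.accept (hJ : Consistent F J) : Consistent F (accept F J x) := by
  unfold _root_.accept
  split_ifs with h
  exacts [h, hJ]

theorem greedyRepair_append_singleton :
    greedyRepair F (l ++ [x]) = accept F (greedyRepair F l) x := by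
  simp [greedyRepair]

theorem greedyRepair_subset_append (l l' : List (DBFact S)) :
    greedyRepair F l ⊆ greedyRepair F (l ++ l') := by
  induction l' using List.reverseRecOn with
  | nil => simp
  | append_singleton l' x ih =>
    rw [← List.append_assoc, greedyRepair_append_singleton]
    exact ih.trans subset_accept

theorem greedyRepair_subset_toFinset : greedyRepair F l ⊆ l.toFinset := by
  induction l using List.reverseRecOn with
  | nil => simp [greedyRepair]
  | append_singleton l x ih =>
    rw [greedyRepair_append_singleton]
    refine accept_subset_insert.trans ?_
    simpa [Finset.union_comm l.toFinset] using Finset.insert_subset_insert x ih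

theorem consistent_greedyRepair : Consistent F (greedyRepair F l) := by
  induction l using List.reverseRecOn with
  | nil => exact consistent_empty
  | append_singleton l x ih => exact greedyRepair_append_singleton ▸ ih.accept

theorem not_consistent_insert_filter_idxOf (hy : y ∈ l) (hyK : y ∉ greedyRepair F l) :
    ¬ Consistent F (insert y ((greedyRepair F l).filter fun x => l.idxOf x < l.idxOf y)) := by
  obtain ⟨l₁, l₂, rfl, hy₁⟩ := List.eq_append_cons_of_mem hy
  intro hc
  have hsub : greedyRepair F l₁ ⊆ (greedyRepair F (l₁ ++ y :: l₂)).filter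
      fun x => (l₁ ++ y :: l₂).idxOf x < (l₁ ++ y :: l₂).idxOf y := fun x hx => by
    have hx₁ : x ∈ l₁ := List.mem_toFinset.1 (greedyRepair_subset_toFinset hx)
    refine Finset.mem_filter.2 ⟨greedyRepair_subset_append _ _ hx, ?_⟩
    rw [List.idxOf_append_of_mem hx₁, List.idxOf_append_of_notMem hy₁]
    exact (List.idxOf_lt_length_of_mem hx₁).trans_le (Nat.le_add_right _ _)
  have hacc : y ∈ accept F (greedyRepair F l₁) y := by
    rw [accept, if_pos (hc.mono (Finset.insert_subset_insert y hsub))]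
    exact Finset.mem_insert_self y _
  rw [← greedyRepair_append_singleton] at hacc
  exact hyK (by simpa using greedyRepair_subset_append (l₁ ++ [y]) l₂ hacc)

theorem greedyRepair_mem_repairs : greedyRepair F l ∈ Repairs F l.toFinset :=
  mem_repairs_iff.2 ⟨greedyRepair_subset_toFinset, consistent_greedyRepair, fun _ hy hyK hc =>
    not_consistent_insert_filter_idxOf (List.mem_toFinset.1 hy) hyK
      (hc.mono (Finset.insert_subset_insert _ (Finset.filter_subset _ _)))⟩

open Classical in
theorem greedyRepair_eq_of_isChoiceSequence (hl : IsChoiceSequence r I l) (hKI : K ⊆ I)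
    (hK : Consistent F K)
    (hblock : ∀ y ∈ I, y ∉ K → ¬ Consistent F (insert y (K.filter (r · y)))) :
    greedyRepair F l = K := by
  have hprefix : ∀ l₁ l₂, l = l₁ ++ l₂ → greedyRepair F l₁ = K.filter (· ∈ l₁) := fun l₁ => by
    induction l₁ using List.reverseRecOn with
    | nil => simp [greedyRepair]
    | append_singleton l₁ y ih =>
      rintro l₂ rfl
      rw [greedyRepair_append_singleton, ih ([y] ++ l₂) (by simp), accept]
      by_cases hy : y ∈ K
      · have hins : insert y (K.filter (· ∈ l₁)) = K.filter (· ∈ l₁ ++ [y]) := by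
          ext z
          by_cases hz : z = y <;> simp [hz, hy]
        rw [hins, if_pos (hK.mono (Finset.filter_subset _ _))]
      · have hbefore : K.filter (r · y) ⊆ K.filter (· ∈ l₁) := fun x hx => by
          obtain ⟨hxK, hxy⟩ := Finset.mem_filter.1 hx
          have hx : x ∈ l₁ ++ [y] ++ l₂ := by
            rw [← List.mem_toFinset, hl.toFinset_eq]
            exact hKI hxK
          simp only [List.append_assoc, List.mem_append, List.mem_singleton] at hx
          rcases hx with hx | rfl | hx
          · exact Finset.mem_filter.2 ⟨hxK, hx⟩
          · exact absurd hxK hy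
          · exact absurd hxy (hl.not_rel_of_append (by simp) hx)
        have hyI : y ∈ I := hl.toFinset_eq ▸ by simp
        rw [if_neg fun hc => hblock y hyI hy (hc.mono (Finset.insert_subset_insert y hbefore))]
        exact Finset.filter_congr fun z hz => by simp [ne_of_mem_of_not_mem hz hy]
  rw [hprefix l [] (by simp)]
  exact Finset.filter_true_of_mem fun x hx => List.mem_toFinset.1 (hl.toFinset_eq ▸ hKI hx)

theorem mem_repairs_iff_exists_greedyRepair : K ∈ Repairs F I ↔
    ∃ l, IsChoiceSequence (fun _ _ => False) I l ∧ greedyRepair F l = K := by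
  classical
  constructor
  · intro hK
    obtain ⟨hKI, hcons, hmax⟩ := mem_repairs_iff.1 hK
    -- The facts of `K` are considered before all others.
    obtain ⟨l, hl⟩ := exists_isChoiceSequence (r := fun x y => x ∈ K ∧ y ∉ K)
      (not_transGen_self_of_lt (f := fun x => if x ∈ K then 0 else 1) (by simp +contextual)) I
    refine ⟨l, hl.mono (by simp), greedyRepair_eq_of_isChoiceSequence hl hKI hcons ?_⟩
    exact fun y hy hyK => by simpa [hyK] using hmax y hy hyK
  · rintro ⟨l, hl, rfl⟩
    exact hl.toFinset_eq ▸ greedyRepair_mem_repairs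

end Greedy

/-! ## Optimal repairs -/

section Optimality

variable {S : Schema} {F : List (DenialConstraint S)} {I K : DBInstance S}
  {r : DBFact S → DBFact S → Prop} {l : List (DBFact S)} {x y : DBFact S}

theorem IsPriority.irrefl (hr : IsPriority F I r) (x : DBFact S) : ¬ r x x :=
  fun h => hr.acyclic x (.single h)

/-- The priority that prefers, of two neighbors in `I`, the one that occurs first in `l`. -/
def listPriority (F : List (DenialConstraint S)) (I : DBInstance S) (l : List (DBFact S))
    (x y : DBFact S) : Prop :=
  Neighbors F I x y ∧ l.idxOf x < l.idxOf y

theorem isTotalPriority_listPriority (hl : I ⊆ l.toFinset) :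
    IsTotalPriority F I (listPriority F I l) := by
  refine ⟨⟨not_transGen_self_of_lt (f := l.idxOf) fun _ _ h => h.2, fun x y h =>
    ⟨h.1.left_mem, h.1.symm.left_mem, h.1⟩⟩, fun r' hr' hext => ?_⟩
  refine funext₂ fun x y => propext ⟨fun hxy => ?_, hext x y⟩
  obtain ⟨hx, -, hn⟩ := hr'.neighbors x y hxy
  refine ⟨hn, lt_of_not_ge fun hyx => ?_⟩
  rcases hyx.lt_or_eq with hyx | hyx
  · exact hr'.acyclic x (.tail (.single hxy) (hext y x ⟨hn.symm, hyx⟩))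
  · have := (List.idxOf_inj (List.mem_toFinset.1 (hl hx))).1 hyx.symm
    exact hr'.irrefl y (this ▸ hxy)

theorem IsPriority.listPriority (hr : IsPriority F I r) (hl : IsChoiceSequence r I l)
    (hxy : r x y) : listPriority F I l x y := by
  obtain ⟨hx, hy, hn⟩ := hr.neighbors x y hxy
  refine ⟨hn, lt_of_not_ge fun hyx => ?_⟩
  have hmem : ∀ z ∈ I, z ∈ l := fun z hz => List.mem_toFinset.1 (hl.toFinset_eq ▸ hz)
  rcases hyx.lt_or_eq with hyx | hyx
  · have := List.pairwise_iff_getElem.1 hl.pairwise _ _ (List.idxOf_lt_length_of_mem (hmem y hy))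
      (List.idxOf_lt_length_of_mem (hmem x hx)) hyx
    simp only [List.getElem_idxOf] at this
    exact this hxy
  · have := (List.idxOf_inj (hmem y hy)).1 hyx
    exact hr.irrefl x (this ▸ hxy)

theorem IsTotalPriority.rel_or_rel (hr : IsTotalPriority F I r) (hxy : Neighbors F I x y)
    (hne : x ≠ y) : r x y ∨ r y x := by
  obtain ⟨l, hl⟩ := exists_isChoiceSequence hr.1.acyclic I
  have heq : listPriority F I l = r := hr.2 _ (isTotalPriority_listPriority hl.toFinset_eq.ge).1
    fun _ _ => hr.1.listPriority hl
  have hx : x ∈ l := List.mem_toFinset.1 (hl.toFinset_eq ▸ hxy.left_mem)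
  rw [← heq]
  exact (Nat.lt_or_gt_of_ne ((List.idxOf_inj hx).not.2 hne)).imp (⟨hxy, ·⟩) (⟨hxy.symm, ·⟩)

open Classical in
theorem globallyOptimal_of_not_consistent_insert (hr : ∀ x, ¬ Relation.TransGen r x x)
    (hKI : K ⊆ I) (hblock : ∀ y ∈ I, y ∉ K → ¬ Consistent F (insert y (K.filter (r · y)))) :
    GloballyOptimal F I r K := by
  refine ⟨hKI, ?_⟩
  rintro ⟨X, Y, ⟨x₀, hx₀⟩, -, hY, hXY, hcons⟩
  obtain ⟨y₀, hy₀, -⟩ := hXY x₀ hx₀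
  obtain ⟨y, hy, hmin⟩ := exists_mem_forall_not_transGen hr ⟨y₀, hy₀⟩
  obtain ⟨hyI, hyK⟩ := Finset.mem_sdiff.1 (hY hy)
  refine hblock y hyI hyK (hcons.mono (Finset.insert_subset (Finset.mem_union_right _ hy) ?_))
  intro x hx
  obtain ⟨hxK, hxy⟩ := Finset.mem_filter.1 hx
  refine Finset.mem_union_left _ (Finset.mem_sdiff.2 ⟨hxK, fun hxX => ?_⟩)
  obtain ⟨y', hy', hyx⟩ := hXY x hxX
  exact hmin y' hy' (.head hyx (.single hxy))

open Classical in
theorem GloballyOptimal.not_consistent_insert (hopt : GloballyOptimal F I r K)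
    (hr : IsTotalPriority F I r) (hK : K ∈ Repairs F I) (hy : y ∈ I) (hyK : y ∉ K) :
    ¬ Consistent F (insert y (K.filter (r · y))) := by
  intro hc
  obtain ⟨hKI, hcons, hmax⟩ := mem_repairs_iff.1 hK
  have hexchange : Consistent F (insert y (K \ K.filter (r y ·))) := by
    refine consistent_insert_of_consistent_insert_neighbors (I := I)
      (hcons.mono Finset.sdiff_subset) (Finset.insert_subset hy (Finset.sdiff_subset.trans hKI))
      (hc.mono (Finset.insert_subset_insert y fun x hx => ?_))
    simp only [Finset.mem_filter, Finset.mem_sdiff, not_and] at hx ⊢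
    obtain ⟨⟨hxK, hyx⟩, hn⟩ := hx
    exact ⟨hxK, (hr.rel_or_rel hn (ne_of_mem_of_not_mem hxK hyK)).resolve_right (hyx hxK)⟩
  refine hopt.2 ⟨K.filter (r y ·), {y}, ?_, Finset.filter_subset _ _, by simp [hy, hyK],
    fun x hx => ⟨y, by simp, (Finset.mem_filter.1 hx).2⟩, ?_⟩
  · refine Finset.nonempty_iff_ne_empty.2 fun hempty => hmax y hy hyK ?_
    rwa [hempty, Finset.sdiff_empty] at hexchange
  · rwa [Finset.union_comm, ← Finset.insert_eq]

theorem commonOptimal_greedyRepair (hr : IsPriority F I r) (hl : IsChoiceSequence r I l) :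
    CommonOptimal F I r (greedyRepair F l) := by
  classical
  have htotal := isTotalPriority_listPriority (F := F) hl.toFinset_eq.ge
  refine ⟨listPriority F I l, htotal, fun _ _ => hr.listPriority hl, ?_⟩
  have hKI : greedyRepair F l ⊆ I := hl.toFinset_eq ▸ greedyRepair_subset_toFinset
  refine globallyOptimal_of_not_consistent_insert htotal.1.acyclic hKI fun y hy hyK hc => ?_
  refine not_consistent_insert_filter_idxOf (List.mem_toFinset.1 (hl.toFinset_eq ▸ hy)) hyK ?_
  refine consistent_insert_of_consistent_insert_neighbors (I := I)
    (consistent_greedyRepair.mono (Finset.filter_subset _ _))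
    (Finset.insert_subset hy ((Finset.filter_subset _ _).trans hKI))
    (hc.mono (Finset.insert_subset_insert y fun x hx => ?_))
  simp only [Finset.mem_filter] at hx ⊢
  exact ⟨hx.1.1, hx.2, hx.1.2⟩

theorem mem_commonRepairs_iff_exists_greedyRepair (hr : IsPriority F I r) :
    K ∈ CommonRepairs F I r ↔ ∃ l, IsChoiceSequence r I l ∧ greedyRepair F l = K := by
  classical
  constructor
  · rintro ⟨hK, r', hr', hext, hopt⟩
    obtain ⟨hKI, hcons, -⟩ := mem_repairs_iff.1 hK
    obtain ⟨l, hl⟩ := exists_isChoiceSequence hr'.1.acyclic I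
    exact ⟨l, hl.mono hext, greedyRepair_eq_of_isChoiceSequence hl hKI hcons
      fun y hy hyK => hopt.not_consistent_insert hr' hK hy hyK⟩
  · rintro ⟨l, hl, rfl⟩
    exact ⟨hl.toFinset_eq ▸ greedyRepair_mem_repairs, commonOptimal_greedyRepair hr hl⟩

theorem CommonOptimal.paretoOptimal (h : CommonOptimal F I r K) : ParetoOptimal F I r K := by
  obtain ⟨r', -, hext, hKI, hopt⟩ := h
  refine ⟨hKI, ?_⟩
  rintro ⟨X, Y, hX, hXK, ⟨y, hy⟩, hY, hXY, hc⟩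
  exact hopt ⟨X, Y, hX, hXK, hY, fun x hx => ⟨y, hy, hext _ _ (hXY x hx y hy)⟩, hc⟩

theorem commonRepairs_subset_paretoRepairs : CommonRepairs F I r ⊆ ParetoRepairs F I r :=
  fun _ hK => ⟨hK.1, hK.2.paretoOptimal⟩

theorem ParetoOptimal.exists_isConflict (hopt : ParetoOptimal F I r K) (hK : K ∈ Repairs F I)
    (hyy : ¬ r y y) (hy : y ∈ I) (hyK : y ∉ K) :
    ∃ C, IsConflict F (insert y K) C ∧ ∀ x ∈ C, ¬ r y x := by
  classical
  by_contra! hdom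
  refine hopt.2 ⟨K.filter (r y ·), {y}, ?_, Finset.filter_subset _ _, by simp, by simp [hy, hyK],
    fun x hx z hz => Finset.mem_singleton.1 hz ▸ (Finset.mem_filter.1 hx).2, ?_⟩
  · have hincons := (mem_repairs_iff.1 hK).2.2 y hy hyK
    rw [consistent_iff_forall_not_isConflict] at hincons
    push Not at hincons
    obtain ⟨C, hC⟩ := hincons
    obtain ⟨x, hx, hyx⟩ := hdom C hC
    have hxK := (Finset.mem_insert.1 (hC.1 hx)).resolve_left fun h => hyy (h ▸ hyx)
    exact ⟨x, Finset.mem_filter.2 ⟨hxK, hyx⟩⟩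
  · refine consistent_iff_forall_not_isConflict.2 fun C hC => ?_
    rw [Finset.union_comm, ← Finset.insert_eq] at hC
    obtain ⟨x, hx, hyx⟩ := hdom C (hC.mono (Finset.insert_subset_insert y Finset.sdiff_subset))
    rcases Finset.mem_insert.1 (hC.1 hx) with rfl | hx
    · exact hyy hyx
    · exact (Finset.mem_sdiff.1 hx).2 (Finset.mem_filter.2 ⟨(Finset.mem_sdiff.1 hx).1, hyx⟩)

theorem paretoOptimal_of_exists_isConflict (hKI : K ⊆ I)
    (h : ∀ y ∈ I, y ∉ K → ∃ C, IsConflict F (insert y K) C ∧ ∀ x ∈ C, ¬ r y x) :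
    ParetoOptimal F I r K := by
  refine ⟨hKI, ?_⟩
  rintro ⟨X, Y, -, -, ⟨y, hy⟩, hY, hXY, hcons⟩
  obtain ⟨hyI, hyK⟩ := Finset.mem_sdiff.1 (hY hy)
  obtain ⟨C, hC, hyC⟩ := h y hyI hyK
  refine consistent_iff_forall_not_isConflict.1 hcons C (hC.of_subset fun x hx => ?_)
  rcases Finset.mem_insert.1 (hC.1 hx) with rfl | hxK
  · exact Finset.mem_union_right _ hy
  · exact Finset.mem_union_left _ (Finset.mem_sdiff.2
      ⟨hxK, fun hxX => hyC x hx (hXY x hxX y hy)⟩)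

theorem paretoOptimal_iff_forall_exists_isConflict (hr : ∀ x, ¬ r x x) (hK : K ∈ Repairs F I) :
    ParetoOptimal F I r K ↔
      ∀ y ∈ I, y ∉ K → ∃ C, IsConflict F (insert y K) C ∧ ∀ x ∈ C, ¬ r y x :=
  ⟨fun h y => h.exists_isConflict hK (hr y),
    paretoOptimal_of_exists_isConflict (mem_repairs_iff.1 hK).1⟩

end Optimality

/-! ## Costs and results of nondeterministic computations -/

namespace Comp

/-- The cost semantics of a computation: with a budget of at least `c`, every run of `m` halts and
uses at most `c` steps, and the results of the runs are exactly the elements of `A`. -/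
def Spec {α : Type} (m : Comp α) (c : ℕ) (A : Set α) : Prop :=
  ∀ b, c ≤ b → none ∉ m b ∧ (∀ a k, some (a, k) ∈ m b → a ∈ A ∧ b ≤ k + c) ∧
    ∀ a ∈ A, ∃ k, some (a, k) ∈ m b

variable {α β : Type} {m : Comp α} {c d : ℕ} {A : Set α}

theorem Spec.mono (h : Spec m c A) (hcd : c ≤ d) : Spec m d A := fun b hb =>
  have ⟨hhalt, hsound, hcomplete⟩ := h b (hcd.trans hb)
  ⟨hhalt, fun a k hk => ⟨(hsound a k hk).1, (hsound a k hk).2.trans (by gcongr)⟩, hcomplete⟩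

theorem Spec.haltsWithin {b : ℕ} (h : Spec m c A) (hb : c ≤ b) : m.HaltsWithin b := (h b hb).1

theorem Spec.results_eq {b : ℕ} (h : Spec m c A) (hb : c ≤ b) : m.results b = A :=
  have ⟨_, hsound, hcomplete⟩ := h b hb
  Set.ext fun a => ⟨fun ⟨k, hk⟩ => (hsound a k hk).1, hcomplete a⟩

theorem spec_ret (a : α) : Spec (ret a) 0 {a} := by
  intro b _
  simp [ret]

theorem Spec.spend (k : ℕ) (h : Spec m c A) : Spec (spend k m) (k + c) A := by
  intro b hb
  obtain ⟨hhalt, hsound, hcomplete⟩ := h (b - k) (by omega)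
  have hk : ¬ b < k := by omega
  simp only [Comp.spend, hk, if_false]
  exact ⟨hhalt, fun a j hj => ⟨(hsound a j hj).1, by have := (hsound a j hj).2; omega⟩, hcomplete⟩

theorem Spec.andThen {f : α → Comp β} {B : α → Set β} (h : Spec m c A)
    (hf : ∀ a ∈ A, Spec (f a) d (B a)) :
    Spec (andThen m f) (c + d) {y | ∃ a ∈ A, y ∈ B a} := by
  intro b hb
  obtain ⟨hhalt, hsound, hcomplete⟩ := h b (by omega)
  have hrest : ∀ a k, some (a, k) ∈ m b → a ∈ A ∧ b ≤ k + c ∧ d ≤ k := fun a k hk =>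
    ⟨(hsound a k hk).1, (hsound a k hk).2, by have := (hsound a k hk).2; omega⟩
  refine ⟨?_, ?_, ?_⟩
  · rintro (⟨h, -⟩ | ⟨a, k, hk, hn⟩)
    · exact hhalt h
    · obtain ⟨ha, -, hd⟩ := hrest a k hk
      exact (hf a ha k hd).1 hn
  · rintro y j (⟨-, h⟩ | ⟨a, k, hk, hy⟩)
    · cases h
    · obtain ⟨ha, hb', hd⟩ := hrest a k hk
      obtain ⟨hyB, hj⟩ := (hf a ha k hd).2.1 y j hy
      exact ⟨⟨a, ha, hyB⟩, by omega⟩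
  · rintro y ⟨a, ha, hy⟩
    obtain ⟨k, hk⟩ := hcomplete a ha
    obtain ⟨j, hj⟩ := (hf a ha k (hrest a k hk).2.2).2.2 y hy
    exact ⟨j, Or.inr ⟨a, k, hk, hj⟩⟩

theorem Spec.andThen_singleton {f : α → Comp β} {a : α} {B : Set β} (h : Spec m c {a})
    (hf : Spec (f a) d B) : Spec (Comp.andThen m f) (c + d) B := by
  simpa using h.andThen (B := fun _ => B) (by rintro _ rfl; exact hf)

theorem spec_choose {l : List α} (hl : l ≠ []) : Spec (choose l) (1 + l.length) {a | a ∈ l} := by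
  have hpick : Spec (fun b => {o | (l = [] ∧ o = none) ∨ ∃ a ∈ l, o = some (a, b)} : Comp α) 0
      {a | a ∈ l} := by
    intro b _
    simp +contextual [hl]
  exact hpick.spend (1 + l.length)

theorem spec_forLoop {body : α → β → Comp β} {g : β → α → β} {l : List α}
    (h : ∀ a ∈ l, ∀ s, Spec (body a s) c {g s a}) (s : β) :
    Spec (forLoop body l s) (l.length * (1 + c)) {l.foldl g s} := by
  induction l generalizing s with
  | nil => exact (spec_ret s).mono (by simp)
  | cons a l ih =>
    have htail := ih (fun a ha => h a (List.mem_cons_of_mem _ ha)) (g s a)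
    exact (((h a List.mem_cons_self s).andThen_singleton htail).spend 1).mono
      (by rw [List.length_cons]; ring_nf; rfl)

/-- The final states reachable by a while-loop with condition `C` and round `step`. -/
inductive Reaches (C : β → Prop) (step : β → Set β) : β → β → Prop where
  | done {s : β} (h : ¬ C s) : Reaches C step s s
  | next {s s' t : β} (h : C s) (hs : s' ∈ step s) (ht : Reaches C step s' t) : Reaches C step s t

section While

variable {cond : β → Comp Bool} {body : β → Comp β} {C : β → Prop} {step : β → Set β}
  {Inv : β → Prop} {μ : β → ℕ} {s : β}

theorem setOf_reaches_of_not (h : ¬ C s) : {t | Reaches C step s t} = {s} := by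
  ext t
  refine ⟨?_, ?_⟩
  · rintro (_ | ⟨hC, _, _⟩)
    exacts [rfl, absurd hC h]
  · rintro rfl
    exact .done h

theorem setOf_reaches (h : C s) :
    {t | Reaches C step s t} = {t | ∃ s' ∈ step s, t ∈ {t | Reaches C step s' t}} := by
  ext t
  refine ⟨?_, fun ⟨s', hs', ht⟩ => .next h hs' ht⟩
  rintro (hC | ⟨-, hs', ht⟩)
  exacts [absurd h hC, ⟨_, hs', ht⟩]

theorem spec_whileRounds
    (hcond : ∀ s, Inv s → Spec (cond s) c {t | t = true ↔ C s})
    (hbody : ∀ s, Inv s → C s → Spec (body s) d (step s))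
    (hstep : ∀ s, Inv s → C s → ∀ s' ∈ step s, Inv s' ∧ μ s' < μ s) (n : ℕ) (s : β)
    (hs : Inv s) (hn : μ s < n) :
    Spec (whileRounds cond body n s) ((μ s + 1) * (1 + c + d)) {t | Reaches C step s t} := by
  induction n generalizing s with
  | zero => omega
  | succ n ih =>
    by_cases hC : C s
    · have hrec : ∀ s' ∈ step s, Spec (whileRounds cond body n s') (μ s * (1 + c + d))
          {t | Reaches C step s' t} := fun s' hs' => by
        obtain ⟨hInv, hlt⟩ := hstep s hs hC s' hs'
        exact (ih s' hInv (by omega)).mono (Nat.mul_le_mul_right _ hlt)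
      have htest : Spec (cond s) c {true} := by simpa [hC] using hcond s hs
      rw [setOf_reaches hC]
      exact ((htest.andThen_singleton ((hbody s hs hC).andThen hrec)).spend 1).mono
        (by ring_nf; rfl)
    · have htest : Spec (cond s) c {false} := by simpa [hC] using hcond s hs
      rw [setOf_reaches_of_not hC]
      exact ((htest.andThen_singleton (spec_ret s)).spend 1).mono (by ring_nf; omega)

theorem spec_whileLoop
    (hcond : ∀ s, Inv s → Spec (cond s) c {t | t = true ↔ C s})
    (hbody : ∀ s, Inv s → C s → Spec (body s) d (step s))
    (hstep : ∀ s, Inv s → C s → ∀ s' ∈ step s, Inv s' ∧ μ s' < μ s) (hs : Inv s) :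
    Spec (whileLoop cond body s) ((μ s + 1) * (1 + c + d)) {t | Reaches C step s t} := by
  intro b hb
  refine spec_whileRounds hcond hbody hstep (b + 1) s hs ?_ b hb
  have hle : (μ s + 1) * 1 ≤ (μ s + 1) * (1 + c + d) := Nat.mul_le_mul_left _ (by omega)
  omega

end While

end Comp

/-! ## Polynomial-time program families -/

theorem setOf_eq_true_iff (p : Prop) [Decidable p] : {t : Bool | t = true ↔ p} = {decide p} := by
  ext t
  by_cases hp : p <;> simp [hp]

namespace Prog

variable {S : Schema} {τ : Ty} {c : Prog S (Ty.denote S) .bool} {d e : Prog S (Ty.denote S) τ}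
  {A : Set (Ty.denote S τ)} {T : Prop} {m n : ℕ}

theorem spec_lit {b : Bool} (hb : b = true ↔ T) :
    (lit b : Prog S (Ty.denote S) .bool).eval.Spec 1 {t : Bool | t = true ↔ T} := by
  have hset : {t : Bool | t = true ↔ T} = {b} := by simp [← hb]
  exact hset ▸ (Comp.spec_ret b).spend 1

theorem spec_ite (hc : c.eval.Spec m {t : Bool | t = true ↔ T}) (hd : T → d.eval.Spec n A)
    (he : ¬ T → e.eval.Spec n A) : (ite c d e).eval.Spec (1 + (m + n)) A := by
  classical
  have hc' : c.eval.Spec m {decide T} := setOf_eq_true_iff T ▸ hc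
  refine (hc'.andThen_singleton ?_).spend 1
  by_cases hT : T
  · simpa only [hT, decide_true, if_true] using hd hT
  · simpa only [hT, decide_false, if_false, Bool.false_eq_true] using he hT

variable {κ : Type} {l : List κ} {test : κ → Prog S (Ty.denote S) .bool} {U : κ → Prop}

theorem spec_all (h : ∀ k ∈ l, (test k).eval.Spec m {t : Bool | t = true ↔ U k}) :
    (all (l.map test)).eval.Spec (l.length * (1 + m) + 1)
      {t : Bool | t = true ↔ ∀ k ∈ l, U k} := by
  induction l with
  | nil => exact (spec_lit (by simp)).mono (by simp)
  | cons k l ih =>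
    have hl := ih fun k' hk' => h k' (List.mem_cons_of_mem k hk')
    refine (spec_ite (h k List.mem_cons_self) (fun hk => ?_) fun hk => ?_).mono
      (by rw [List.length_cons]; ring_nf; rfl : 1 + (m + (l.length * (1 + m) + 1)) ≤ _)
    · simpa [hk] using hl
    · exact (spec_lit (by simp [hk])).mono (Nat.le_add_left _ _)

theorem spec_any (h : ∀ k ∈ l, (test k).eval.Spec m {t : Bool | t = true ↔ U k}) :
    (any (l.map test)).eval.Spec (l.length * (1 + m) + 1)
      {t : Bool | t = true ↔ ∃ k ∈ l, U k} := by
  induction l with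
  | nil => exact (spec_lit (by simp)).mono (by simp)
  | cons k l ih =>
    have hl := ih fun k' hk' => h k' (List.mem_cons_of_mem k hk')
    refine (spec_ite (h k List.mem_cons_self) (fun hk => ?_) fun hk => ?_).mono
      (by rw [List.length_cons]; ring_nf; rfl : 1 + (m + (l.length * (1 + m) + 1)) ≤ _)
    · exact (spec_lit (by simp [hk])).mono (Nat.le_add_left _ _)
    · simpa [hk] using hl

end Prog

/-- A parametrized collection of inputs: the parameters `ι` that occur, and the size with respect
to which running times are measured. Statements about open programs are statements about families
of programs, the parameter carrying the values of the free variables. -/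
structure InputFamily (ι : Type) where
  Valid : ι → Prop
  size : ι → ℕ

namespace InputFamily

variable {ι κ α : Type}

/-- The inputs of `P` together with the value of one further variable, which is subject to `R` and
does not count towards the size: bounds are uniform in it. -/
def extend (P : InputFamily ι) (R : ι → α → Prop) : InputFamily (ι × α) where
  Valid q := P.Valid q.1 ∧ R q.1 q.2
  size q := P.size q.1

/-- `f` is bounded on the inputs of `P` by a polynomial in their size. -/
def PolyBounded (P : InputFamily ι) (f : ι → ℕ) : Prop :=
  ∃ p : Polynomial ℕ, ∀ i, P.Valid i → f i ≤ p.eval (P.size i)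

variable {P : InputFamily ι} {f g : ι → ℕ}

theorem polyBounded_const (n : ℕ) : P.PolyBounded fun _ => n :=
  ⟨.C n, fun _ _ => by simp⟩

theorem polyBounded_eval (p : Polynomial ℕ) : P.PolyBounded fun i => p.eval (P.size i) :=
  ⟨p, fun _ _ => le_rfl⟩

theorem polyBounded_size : P.PolyBounded P.size :=
  ⟨.X, fun _ _ => by simp⟩

theorem PolyBounded.of_le (hg : P.PolyBounded g) (h : ∀ i, P.Valid i → f i ≤ g i) :
    P.PolyBounded f :=
  hg.imp fun _ hp i hi => (h i hi).trans (hp i hi)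

theorem PolyBounded.add (hf : P.PolyBounded f) (hg : P.PolyBounded g) :
    P.PolyBounded fun i => f i + g i :=
  have ⟨p, hp⟩ := hf
  have ⟨q, hq⟩ := hg
  ⟨p + q, fun i hi => by simpa using add_le_add (hp i hi) (hq i hi)⟩

theorem PolyBounded.mul (hf : P.PolyBounded f) (hg : P.PolyBounded g) :
    P.PolyBounded fun i => f i * g i :=
  have ⟨p, hp⟩ := hf
  have ⟨q, hq⟩ := hg
  ⟨p * q, fun i hi => by simpa using Nat.mul_le_mul (hp i hi) (hq i hi)⟩

theorem PolyBounded.pow (hf : P.PolyBounded f) (n : ℕ) : P.PolyBounded fun i => f i ^ n :=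
  have ⟨p, hp⟩ := hf
  ⟨p ^ n, fun i hi => by simpa using Nat.pow_le_pow_left (hp i hi) n⟩

theorem PolyBounded.comp {Q : InputFamily κ} (hf : P.PolyBounded f) (φ : κ → ι)
    (hvalid : ∀ k, Q.Valid k → P.Valid (φ k)) (hsize : ∀ k, P.size (φ k) = Q.size k) :
    Q.PolyBounded fun k => f (φ k) :=
  hf.imp fun _ hp k hk => hsize k ▸ hp (φ k) (hvalid k hk)

theorem PolyBounded.extend (hf : P.PolyBounded f) (R : ι → α → Prop) :
    (P.extend R).PolyBounded fun q => f q.1 :=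
  hf.comp Prod.fst (fun _ hq => hq.1) fun _ => rfl

variable {S : Schema} {σ τ υ : Ty}

/-- The programs `e i` run in polynomial time on the inputs of `P`, and the results of the runs of
`e i` are exactly the elements of `A i`. -/
def PolyTime (P : InputFamily ι) (e : ι → Prog S (Ty.denote S) τ) (A : ι → Set (Ty.denote S τ)) :
    Prop :=
  ∃ p : Polynomial ℕ, ∀ i, P.Valid i → (e i).eval.Spec (p.eval (P.size i)) (A i)

/-- Every run of `e i` returns `v i`, in polynomial time. -/
def Computes (P : InputFamily ι) (e : ι → Prog S (Ty.denote S) τ) (v : ι → Ty.denote S τ) :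
    Prop :=
  P.PolyTime e fun i => {v i}

/-- Every run of `e i` returns the truth value of `T i`, in polynomial time. -/
def Decides (P : InputFamily ι) (e : ι → Prog S (Ty.denote S) .bool) (T : ι → Prop) : Prop :=
  P.PolyTime e fun i => {t : Bool | t = true ↔ T i}

variable {e : ι → Prog S (Ty.denote S) τ} {A B : ι → Set (Ty.denote S τ)} {v w : ι → Ty.denote S τ}
  {c : ι → Prog S (Ty.denote S) .bool} {T U : ι → Prop}

theorem PolyBounded.polyTime (hf : P.PolyBounded f)
    (h : ∀ i, P.Valid i → (e i).eval.Spec (f i) (A i)) : P.PolyTime e A :=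
  hf.imp fun _ hp i hi => (h i hi).mono (hp i hi)

theorem PolyTime.congr (h : P.PolyTime e A) (hAB : ∀ i, P.Valid i → A i = B i) :
    P.PolyTime e B :=
  h.imp fun _ hp i hi => hAB i hi ▸ hp i hi

theorem PolyTime.comp {Q : InputFamily κ} (h : P.PolyTime e A) (φ : κ → ι)
    (hvalid : ∀ k, Q.Valid k → P.Valid (φ k)) (hsize : ∀ k, P.size (φ k) = Q.size k) :
    Q.PolyTime (fun k => e (φ k)) fun k => A (φ k) :=
  h.imp fun _ hp k hk => hsize k ▸ hp (φ k) (hvalid k hk)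

theorem Computes.congr (h : P.Computes e v) (hvw : ∀ i, P.Valid i → v i = w i) :
    P.Computes e w :=
  PolyTime.congr h fun i hi => by rw [hvw i hi]

theorem Decides.congr (h : P.Decides c T) (hTU : ∀ i, P.Valid i → (T i ↔ U i)) :
    P.Decides c U :=
  PolyTime.congr h fun i hi => by simp only [hTU i hi]

theorem Computes.decides {v : ι → Bool} (h : P.Computes c v) (hv : ∀ i, v i = true ↔ T i) :
    P.Decides c T :=
  PolyTime.congr h fun i _ => by
    have hset : {t : Bool | t = true ↔ T i} = {v i} := by simp [← hv]
    exact hset.symm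

theorem Decides.computes [DecidablePred T] (h : P.Decides c T) :
    P.Computes c fun i => decide (T i) :=
  PolyTime.congr h fun i _ => setOf_eq_true_iff (T i)

/-! ### Instructions -/

theorem computes_var (τ : Ty) (v : ι → Ty.denote S τ) : P.Computes (fun i => .var (v i)) v :=
  (polyBounded_const 1).polyTime fun i _ => (Comp.spec_ret (v i)).spend 1

theorem decides_lit (b : Bool) : P.Decides (S := S) (fun _ => .lit b) fun _ => b = true :=
  (polyBounded_const 1).polyTime fun _ _ => Prog.spec_lit Iff.rfl

theorem computes_nil : P.Computes (S := S) (τ := .list τ) (fun _ => .nil) fun _ => [] :=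
  (polyBounded_const 1).polyTime fun _ _ => (Comp.spec_ret _).spend 1

theorem PolyTime.bind {d : ι → Prog S (Ty.denote S) σ} {D : ι → Set (Ty.denote S σ)}
    {k : ι × Ty.denote S σ → Prog S (Ty.denote S) τ}
    {B : ι × Ty.denote S σ → Set (Ty.denote S τ)} (hd : P.PolyTime d D)
    (hk : (P.extend fun i a => a ∈ D i).PolyTime k B) :
    P.PolyTime (fun i => .bind (d i) fun a => k (i, a)) fun i => {y | ∃ a ∈ D i, y ∈ B (i, a)} :=
  have ⟨p, hp⟩ := hd
  have ⟨q, hq⟩ := hk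
  ((polyBounded_const 1).add ((polyBounded_eval p).add (polyBounded_eval q))).polyTime fun i hi =>
    ((hp i hi).andThen fun a ha => hq (i, a) ⟨hi, ha⟩).spend 1

theorem Computes.bind {d : ι → Prog S (Ty.denote S) σ} {u : ι → Ty.denote S σ}
    {k : ι → Ty.denote S σ → Prog S (Ty.denote S) τ} (hd : P.Computes d u)
    (hk : P.PolyTime (fun i => k i (u i)) A) : P.PolyTime (fun i => .bind (d i) (k i)) A :=
  have ⟨p, hp⟩ := hd
  have ⟨q, hq⟩ := hk
  ((polyBounded_const 1).add ((polyBounded_eval p).add (polyBounded_eval q))).polyTime fun i hi =>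
    ((hp i hi).andThen_singleton (hq i hi)).spend 1

open Classical in
theorem Decides.ite {d e : ι → Prog S (Ty.denote S) τ} (hc : P.Decides c T) (hd : P.PolyTime d A)
    (he : P.PolyTime e B) :
    P.PolyTime (fun i => .ite (c i) (d i) (e i)) fun i => if T i then A i else B i :=
  have ⟨p, hp⟩ := hc
  have ⟨q, hq⟩ := hd
  have ⟨r, hr⟩ := he
  ((polyBounded_const 1).add ((polyBounded_eval p).add
    ((polyBounded_eval q).add (polyBounded_eval r)))).polyTime fun i hi =>
    Prog.spec_ite (hp i hi)
      (fun hT => if_pos hT ▸ (hq i hi).mono (Nat.le_add_right _ _))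
      (fun hT => if_neg hT ▸ (hr i hi).mono (Nat.le_add_left _ _))

theorem Decides.computes_ite {d e : ι → Prog S (Ty.denote S) τ} [DecidablePred T]
    (hc : P.Decides c T) (hd : P.Computes d v) (he : P.Computes e w) :
    P.Computes (fun i => .ite (c i) (d i) (e i)) fun i => if T i then v i else w i :=
  PolyTime.congr (hc.ite hd he) fun i _ => by
    by_cases hT : T i <;> simp only [hT, if_true, if_false]

theorem PolyTime.snd {d : ι → Prog S (Ty.denote S) (.prod σ τ)}
    {D : ι → Set (Ty.denote S (.prod σ τ))} (hd : P.PolyTime d D) :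
    P.PolyTime (fun i => .snd (d i)) fun i => {y | ∃ x ∈ D i, y = x.2} :=
  have ⟨p, hp⟩ := hd
  ((polyBounded_const 1).add (polyBounded_eval p)).polyTime fun i hi =>
    ((hp i hi).andThen (d := 0) fun x _ => Comp.spec_ret x.2).spend 1

section Operands

variable {d : ι → Prog S (Ty.denote S) σ} {d' : ι → Prog S (Ty.denote S) υ}
  {u : ι → Ty.denote S σ} {u' : ι → Ty.denote S υ}

theorem Computes.polyTime_of_eval_eq (hd : P.Computes d u)
    {m : ι → Ty.denote S σ → Comp (Ty.denote S τ)}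
    (heval : ∀ i, (e i).eval = .spend 1 ((d i).eval.andThen (m i))) (hf : P.PolyBounded f)
    (hm : ∀ i, P.Valid i → (m i (u i)).Spec (f i) (A i)) : P.PolyTime e A :=
  have ⟨p, hp⟩ := hd
  ((polyBounded_const 1).add ((polyBounded_eval p).add hf)).polyTime fun i hi =>
    heval i ▸ ((hp i hi).andThen_singleton (hm i hi)).spend 1

theorem Computes.polyTime_of_eval_eq₂ (hd : P.Computes d u) (hd' : P.Computes d' u')
    {m : ι → Ty.denote S σ → Ty.denote S υ → Comp (Ty.denote S τ)}
    (heval : ∀ i, (e i).eval =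
      .spend 1 ((d i).eval.andThen fun x => (d' i).eval.andThen fun y => m i x y))
    (hf : P.PolyBounded f) (hm : ∀ i, P.Valid i → (m i (u i) (u' i)).Spec (f i) (A i)) :
    P.PolyTime e A :=
  have ⟨q, hq⟩ := hd'
  hd.polyTime_of_eval_eq heval ((polyBounded_eval q).add hf) fun i hi =>
    (hq i hi).andThen_singleton (hm i hi)

theorem Computes.pair (hd : P.Computes d u) (hd' : P.Computes d' u') :
    P.Computes (fun i => .pair (d i) (d' i)) fun i => (u i, u' i) :=
  hd.polyTime_of_eval_eq₂ hd' (fun _ => rfl) (polyBounded_const 0) fun _ _ => Comp.spec_ret _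

theorem Computes.fst {d : ι → Prog S (Ty.denote S) (.prod σ τ)}
    {u : ι → Ty.denote S (.prod σ τ)} (hd : P.Computes d u) :
    P.Computes (fun i => .fst (d i)) fun i => (u i).1 :=
  hd.polyTime_of_eval_eq (fun _ => rfl) (polyBounded_const 0) fun _ _ => Comp.spec_ret _

theorem Computes.snd {d : ι → Prog S (Ty.denote S) (.prod σ τ)}
    {u : ι → Ty.denote S (.prod σ τ)} (hd : P.Computes d u) :
    P.Computes (fun i => .snd (d i)) fun i => (u i).2 :=
  hd.polyTime_of_eval_eq (fun _ => rfl) (polyBounded_const 0) fun _ _ => Comp.spec_ret _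

end Operands

section Lists

variable {l : ι → Prog S (Ty.denote S) (.list σ)} {L : ι → List (Ty.denote S σ)}

theorem Computes.cons {d : ι → Prog S (Ty.denote S) σ} {u : ι → Ty.denote S σ}
    (hd : P.Computes d u) (hl : P.Computes l L) :
    P.Computes (fun i => .cons (d i) (l i)) fun i => (u i :: L i : List (Ty.denote S σ)) :=
  hd.polyTime_of_eval_eq₂ hl (fun _ => rfl) (polyBounded_const 0) fun _ _ => Comp.spec_ret _

theorem Computes.isNil (hl : P.Computes l L) :
    P.Decides (fun i => .isNil (l i)) fun i => L i = [] :=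
  have h : P.Computes (fun i => .isNil (l i)) fun i => (L i).isEmpty :=
    hl.polyTime_of_eval_eq (fun _ => rfl) (polyBounded_const 0) fun _ _ => Comp.spec_ret _
  h.decides fun _ => List.isEmpty_iff

theorem Computes.choose (hl : P.Computes l L) (hne : ∀ i, P.Valid i → L i ≠ [])
    (hlen : P.PolyBounded fun i => (L i).length) :
    P.PolyTime (fun i => .choose (l i)) fun i => {x | x ∈ L i} :=
  hl.polyTime_of_eval_eq (fun _ => rfl) ((polyBounded_const 1).add hlen) fun i hi =>
    Comp.spec_choose (hne i hi)

theorem Computes.forIn {init : ι → Prog S (Ty.denote S) τ} {s : ι → Ty.denote S τ}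
    {body : ι × Ty.denote S σ × Ty.denote S τ → Prog S (Ty.denote S) τ}
    {g : ι × Ty.denote S σ × Ty.denote S τ → Ty.denote S τ}
    (hl : P.Computes l L) (hlen : P.PolyBounded fun i => (L i).length)
    (hinit : P.Computes init s)
    (hbody : (P.extend fun i (q : Ty.denote S σ × Ty.denote S τ) => q.1 ∈ L i).Computes
      body g) :
    P.Computes (fun i => .forIn (l i) (init i) fun x t => body (i, x, t))
      fun i => (L i).foldl (fun t x => g (i, x, t)) (s i) :=
  have ⟨p, hp⟩ := hbody
  hl.polyTime_of_eval_eq₂ hinit (fun _ => rfl)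
    (hlen.mul ((polyBounded_const 1).add (polyBounded_eval p))) fun i hi =>
    Comp.spec_forLoop (fun a ha t => hp (i, a, t) ⟨hi, ha⟩) (s i)

end Lists

theorem Computes.whileDo {init : ι → Prog S (Ty.denote S) τ} {s : ι → Ty.denote S τ}
    {cond : ι × Ty.denote S τ → Prog S (Ty.denote S) .bool}
    {body : ι × Ty.denote S τ → Prog S (Ty.denote S) τ} {Inv : ι → Ty.denote S τ → Prop}
    {C : ι × Ty.denote S τ → Prop} {step : ι × Ty.denote S τ → Set (Ty.denote S τ)}
    {μ : Ty.denote S τ → ℕ} (hinit : P.Computes init s) (hInv : ∀ i, P.Valid i → Inv i (s i))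
    (hμ : P.PolyBounded fun i => μ (s i)) (hcond : (P.extend Inv).Decides cond C)
    (hbody : (P.extend fun i t => Inv i t ∧ C (i, t)).PolyTime body step)
    (hstep : ∀ i, P.Valid i → ∀ t, Inv i t → C (i, t) → ∀ t' ∈ step (i, t),
      Inv i t' ∧ μ t' < μ t) :
    P.PolyTime (fun i => .whileDo (init i) (fun t => cond (i, t)) fun t => body (i, t))
      fun i => {t | Comp.Reaches (fun t => C (i, t)) (fun t => step (i, t)) (s i) t} :=
  have ⟨p, hp⟩ := hcond
  have ⟨q, hq⟩ := hbody
  hinit.polyTime_of_eval_eq (fun _ => rfl)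
    ((hμ.add (polyBounded_const 1)).mul
      (((polyBounded_const 1).add (polyBounded_eval p)).add (polyBounded_eval q))) fun i hi =>
    Comp.spec_whileLoop (fun t ht => hp (i, t) ⟨hi, ht⟩) (fun t ht hC => hq (i, t) ⟨hi, ht, hC⟩)
      (hstep i hi) (hInv i hi)

/-! ### Tests -/

section Facts

variable {a b : ι → Prog S (Ty.denote S) .fact} {x y : ι → DBFact S}

open Classical in
theorem Computes.relIs (R : ι → S.Rel) (ha : P.Computes a x) :
    P.Decides (fun i => .relIs (R i) (a i)) fun i => (x i).rel = R i :=
  have h : P.Computes (fun i => .relIs (R i) (a i)) fun i => decide ((x i).rel = R i) :=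
    ha.polyTime_of_eval_eq (fun _ => rfl) (polyBounded_const 0) fun _ _ => Comp.spec_ret _
  h.decides fun _ => decide_eq_true_iff

theorem Computes.arg (n : ι → ℕ) (ha : P.Computes a x) :
    P.Computes (fun i => .arg (n i) (a i)) fun i => (x i).args.getD (n i) (.num 0) :=
  ha.polyTime_of_eval_eq (fun _ => rfl) (polyBounded_const 0) fun _ _ => Comp.spec_ret _

open Classical in
theorem Computes.eqFact (ha : P.Computes a x) (hb : P.Computes b y)
    (hx : P.PolyBounded fun i => (x i).size) (hy : P.PolyBounded fun i => (y i).size) :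
    P.Decides (fun i => .eqFact (a i) (b i)) fun i => x i = y i :=
  have h : P.Computes (fun i => .eqFact (a i) (b i)) fun i => decide (x i = y i) :=
    ha.polyTime_of_eval_eq₂ hb (fun _ => rfl) (hx.add hy) fun _ _ => (Comp.spec_ret _).spend _
  h.decides fun _ => decide_eq_true_iff

end Facts

open Classical in
theorem Computes.cmp {a b : ι → Prog S (Ty.denote S) .const} {x y : ι → Constant}
    (op : BuiltIn) (ha : P.Computes a x) (hb : P.Computes b y)
    (hx : P.PolyBounded fun i => (x i).size) (hy : P.PolyBounded fun i => (y i).size) :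
    P.Decides (fun i => .cmp op (a i) (b i)) fun i => op.Holds (x i) (y i) :=
  have h : P.Computes (fun i => .cmp op (a i) (b i)) fun i => decide (op.Holds (x i) (y i)) :=
    ha.polyTime_of_eval_eq₂ hb (fun _ => rfl) ((hx.add hy).pow 2) fun _ _ =>
      (Comp.spec_ret _).spend _
  h.decides fun _ => decide_eq_true_iff

section Connectives

variable {a b : ι → Prog S (Ty.denote S) .bool}

theorem Decides.decides_ite {U : ι → Prop} {V : ι → Prop} (hc : P.Decides c T) (ha : P.Decides a U)
    (hb : P.Decides b V) :
    P.Decides (fun i => .ite (c i) (a i) (b i)) fun i => (T i → U i) ∧ (¬ T i → V i) :=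
  PolyTime.congr (hc.ite ha hb) fun i _ => by by_cases hT : T i <;> simp [hT]

theorem Decides.not (hc : P.Decides c T) : P.Decides (fun i => .not (c i)) fun i => ¬ T i :=
  (hc.decides_ite (decides_lit false) (decides_lit true)).congr fun i _ => by simp

theorem Decides.and (hc : P.Decides c T) (ha : P.Decides a U) :
    P.Decides (fun i => .and (c i) (a i)) fun i => T i ∧ U i :=
  (hc.decides_ite ha (decides_lit false)).congr fun i _ => by simp; tauto

theorem Decides.or (hc : P.Decides c T) (ha : P.Decides a U) :
    P.Decides (fun i => .or (c i) (a i)) fun i => T i ∨ U i :=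
  (hc.decides_ite (decides_lit true) ha).congr fun i _ => by simp; tauto

end Connectives

section ManyTests

variable {L : ι → List κ} {e : ι × κ → Prog S (Ty.denote S) .bool} {U : ι × κ → Prop}

theorem Decides.all (hlen : P.PolyBounded fun i => (L i).length)
    (he : (P.extend fun i k => k ∈ L i).Decides e U) :
    P.Decides (fun i => .all ((L i).map fun k => e (i, k))) fun i => ∀ k ∈ L i, U (i, k) :=
  have ⟨p, hp⟩ := he
  ((hlen.mul ((polyBounded_const 1).add (polyBounded_eval p))).add (polyBounded_const 1)).polyTime
    fun i hi => Prog.spec_all fun k hk => hp (i, k) ⟨hi, hk⟩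

theorem Decides.any (hlen : P.PolyBounded fun i => (L i).length)
    (he : (P.extend fun i k => k ∈ L i).Decides e U) :
    P.Decides (fun i => .any ((L i).map fun k => e (i, k))) fun i => ∃ k ∈ L i, U (i, k) :=
  have ⟨p, hp⟩ := he
  ((hlen.mul ((polyBounded_const 1).add (polyBounded_eval p))).add (polyBounded_const 1)).polyTime
    fun i hi => Prog.spec_any fun k hk => hp (i, k) ⟨hi, hk⟩

theorem decides_any_map {l : List κ} {e : ι → κ → Prog S (Ty.denote S) .bool} {U : ι → κ → Prop}
    (h : ∀ k ∈ l, P.Decides (fun i => e i k) fun i => U i k) :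
    P.Decides (fun i => .any (l.map (e i))) fun i => ∃ k ∈ l, U i k := by
  induction l with
  | nil => exact (decides_lit false).congr fun i _ => by simp
  | cons k l ih =>
    have hl := ih fun k' hk' => h k' (List.mem_cons_of_mem k hk')
    exact ((h k List.mem_cons_self).or hl).congr fun i _ => by simp

end ManyTests

section ListTraversal

theorem foldl_decide_or_eq_true (U : α → Prop) [DecidablePred U] (l : List α) (b : Bool) :
    l.foldl (fun t x => decide (t = true ∨ U x)) b = true ↔ b = true ∨ ∃ x ∈ l, U x := by
  induction l generalizing b with
  | nil => simp
  | cons x l ih => rw [List.foldl_cons, ih]; simp [or_assoc]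

theorem foldl_ite_cons (U : α → Prop) [DecidablePred U] (l : List α) :
    l.foldl (fun acc x => if U x then x :: acc else acc) [] = (l.filter (U ·)).reverse := by
  rw [← List.append_nil (List.reverse _), ← List.foldl_flip_cons_eq_append', List.foldl_filter]
  simp only [decide_eq_true_eq]

variable {l : ι → Prog S (Ty.denote S) (.list σ)} {L : ι → List (Ty.denote S σ)}
  {test : ι × Ty.denote S σ → Prog S (Ty.denote S) .bool} {U : ι × Ty.denote S σ → Prop}

theorem Computes.existsIn (hl : P.Computes l L) (hlen : P.PolyBounded fun i => (L i).length)
    (htest : (P.extend fun i x => x ∈ L i).Decides test U) :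
    P.Decides (fun i => .existsIn (l i) fun x => test (i, x)) fun i => ∃ x ∈ L i, U (i, x) := by
  classical
  have htest' : (P.extend fun i (q : Ty.denote S σ × Bool) => q.1 ∈ L i).Decides
      (fun q => test (q.1, q.2.1)) fun q => U (q.1, q.2.1) :=
    PolyTime.comp htest (fun q : ι × Ty.denote S σ × Bool => (q.1, q.2.1)) (fun _ hq => hq)
      fun _ => rfl
  have hfound : (P.extend fun i (q : Ty.denote S σ × Bool) => q.1 ∈ L i).Decides (S := S)
      (fun q => .var (τ := .bool) q.2.2) fun q => q.2.2 = true :=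
    (computes_var .bool fun q : ι × Ty.denote S σ × Bool => q.2.2).decides fun _ => Iff.rfl
  exact (hl.forIn hlen (decides_lit false).computes (hfound.or htest').computes).decides fun i =>
    (foldl_decide_or_eq_true (fun x => U (i, x)) (L i) _).trans (by simp)

theorem Computes.filter [DecidablePred U] (hl : P.Computes l L)
    (hlen : P.PolyBounded fun i => (L i).length)
    (htest : (P.extend fun i x => x ∈ L i).Decides test U) :
    P.Computes (fun i => .filter (l i) fun x => test (i, x))
      fun i => ((L i).filter fun x => U (i, x)).reverse := by
  have htest' : (P.extend fun i (q : Ty.denote S σ × List (Ty.denote S σ)) => q.1 ∈ L i).Decides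
      (fun q => test (q.1, q.2.1)) fun q => U (q.1, q.2.1) :=
    PolyTime.comp htest (fun q : ι × Ty.denote S σ × List (Ty.denote S σ) => (q.1, q.2.1))
      (fun _ hq => hq) fun _ => rfl
  have hacc := computes_var (P := P.extend fun i (q : Ty.denote S σ × List (Ty.denote S σ)) =>
    q.1 ∈ L i) (.list σ) fun q => q.2.2
  have hbody := htest'.computes_ite ((computes_var σ fun q => q.2.1).cons hacc) hacc
  exact (hl.forIn hlen computes_nil hbody).congr fun i _ => foldl_ite_cons (fun x => U (i, x)) (L i)

end ListTraversal

end InputFamily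

/-! ## Sizes -/

section Sizes

variable {S : Schema}

/-- The size of a list of facts, the measure in which the running times of the tests on it are
bounded. -/
def totalSize (l : List (DBFact S)) : ℕ := (l.map DBFact.size).sum

variable {l : List (DBFact S)} {x : DBFact S}

@[simp]
theorem totalSize_cons (x : DBFact S) (l : List (DBFact S)) :
    totalSize (x :: l) = x.size + totalSize l := by
  simp [totalSize]

theorem totalSize_reverse (l : List (DBFact S)) : totalSize l.reverse = totalSize l := by
  simp [totalSize]

theorem size_le_totalSize (hx : x ∈ l) : x.size ≤ totalSize l :=
  List.le_sum_of_mem (List.mem_map_of_mem hx)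

theorem length_le_totalSize (l : List (DBFact S)) : l.length ≤ totalSize l := by
  simpa [totalSize] using
    List.card_nsmul_le_sum (l.map DBFact.size) 1 (by simp [DBFact.size])

theorem totalSize_filter_le (p : DBFact S → Bool) (l : List (DBFact S)) :
    totalSize (l.filter p) ≤ totalSize l :=
  (List.filter_sublist.map _).sum_le_sum fun _ _ => Nat.zero_le _

theorem totalSize_le_of_nodup {k : List (DBFact S)} (hk : k.Nodup) (hkl : k ⊆ l) :
    totalSize k ≤ totalSize l :=
  have ⟨_, hperm, hsub⟩ := hk.subperm hkl
  (hperm.map DBFact.size).sum_eq.ge.trans <|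
    (hsub.map DBFact.size).sum_le_sum fun _ _ => Nat.zero_le _

theorem totalSize_filter_ne_add_size_le (hx : x ∈ l) :
    totalSize (l.filter (· ≠ x)) + x.size ≤ totalSize l := by
  induction l with
  | nil => simp at hx
  | cons y l ih =>
    by_cases hyx : y = x
    · subst hyx
      have := totalSize_filter_le (· ≠ y) l
      simpa [add_comm y.size] using this
    · have hxl : x ∈ l := by simpa [Ne.symm hyx] using hx
      simpa [hyx, add_assoc] using ih hxl

theorem Constant.size_getD_args_le (x : DBFact S) (n : ℕ) :
    (x.args.getD n (.num 0)).size ≤ x.size + 2 := by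
  rcases lt_or_ge n x.args.length with hn | hn
  · rw [List.getD_eq_getElem _ _ hn]
    have := List.le_sum_of_mem (List.mem_map_of_mem (f := Constant.size) (List.getElem_mem hn))
    simp only [DBFact.size]
    omega
  · rw [List.getD_eq_default _ _ hn]
    simp [Constant.size]

end Sizes

namespace InputFamily

variable {ι : Type} {P : InputFamily ι} {S : Schema} {x y : ι → DBFact S}
  {l : ι → List (DBFact S)} {prio : ι → List (DBFact S × DBFact S)}

theorem PolyBounded.length (hl : P.PolyBounded fun i => totalSize (l i)) :
    P.PolyBounded fun i => (l i).length :=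
  hl.of_le fun i _ => length_le_totalSize (l i)

theorem PolyBounded.size_of_mem (hl : P.PolyBounded fun i => totalSize (l i)) :
    (P.extend fun i x => x ∈ l i).PolyBounded fun q => q.2.size :=
  (hl.extend _).of_le fun _ hq => size_le_totalSize hq.2

theorem decides_mem (hx : P.PolyBounded fun i => (x i).size)
    (hl : P.PolyBounded fun i => totalSize (l i)) :
    P.Decides (fun i => .mem (x i) (l i)) fun i => x i ∈ l i := by
  have htest := (computes_var .fact Prod.snd).eqFact (computes_var .fact _) hl.size_of_mem
    (hx.extend _)
  exact ((computes_var (.list .fact) l).existsIn hl.length htest).congr fun i _ =>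
    ⟨fun ⟨_, hy, hyx⟩ => hyx ▸ hy, fun hx => ⟨_, hx, rfl⟩⟩

theorem computes_remove (hx : P.PolyBounded fun i => (x i).size)
    (hl : P.PolyBounded fun i => totalSize (l i)) :
    P.Computes (fun i => .remove (x i) (l i)) fun i => ((l i).filter (· ≠ x i)).reverse := by
  have htest := (computes_var .fact Prod.snd).eqFact (computes_var .fact _) hl.size_of_mem
    (hx.extend _)
  classical
  exact ((computes_var (.list .fact) l).filter hl.length htest.not).congr fun i _ => by congr!

theorem decides_dominates (hx : P.PolyBounded fun i => (x i).size)
    (hy : P.PolyBounded fun i => (y i).size)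
    (hprio : P.PolyBounded fun i => ((prio i).map fun q => q.1.size + q.2.size).sum) :
    P.Decides (fun i => .dominates (prio i) (x i) (y i)) fun i => (x i, y i) ∈ prio i := by
  have hsize : (P.extend fun i q => q ∈ prio i).PolyBounded fun q => q.2.1.size + q.2.2.size :=
    (hprio.extend _).of_le fun q hq => List.le_sum_of_mem
      (List.mem_map_of_mem (f := fun q : DBFact S × DBFact S => q.1.size + q.2.size) hq.2)
  have hlen : P.PolyBounded fun i => (prio i).length := hprio.of_le fun i _ => by
    simpa using List.card_nsmul_le_sum ((prio i).map fun q => q.1.size + q.2.size) 1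
      (by simp only [List.mem_map, DBFact.size]; omega)
  have hp := computes_var (P := P.extend fun i q => q ∈ prio i) (.prod .fact .fact) fun q => q.2
  have htest := (hp.fst.eqFact (computes_var .fact _) (hsize.of_le fun _ _ => Nat.le_add_right _ _)
    (hx.extend _)).and
    (hp.snd.eqFact (computes_var .fact _) (hsize.of_le fun _ _ => Nat.le_add_left _ _)
    (hy.extend _))
  exact ((computes_var (.list (.prod .fact .fact)) prio).existsIn hlen htest).congr fun i _ =>
    ⟨fun ⟨_, hq, h₁, h₂⟩ => h₁ ▸ h₂ ▸ hq, fun h => ⟨_, h, rfl, rfl⟩⟩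

end InputFamily

/-! ## Recognizing instances of a constraint -/

section Instances

variable {S : Schema} {F : List (DenialConstraint S)} {c : DenialConstraint S} {n : ℕ}
  {as : List (RelAtom S n)} {fs : List (DBFact S)} {ρ : Fin n → Constant}
  {slots : List (Fin n × ℕ × DBFact S)} {I C : DBInstance S} {a : RelAtom S n} {f : DBFact S}
  {v : Fin n} {j : ℕ}

/-- `fs` is the sequence of facts to which the atoms of `c` are turned by some admissible
substitution that satisfies the condition of `c`. -/
def DenialConstraint.IsInstance (c : DenialConstraint S) (fs : List (DBFact S)) : Prop :=
  ∃ ρ, c.Admissible ρ ∧ c.cond.Holds ρ ∧ List.Forall₂ (fun a f => a.Matches ρ f) c.atoms fs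

theorem isConflict_iff_exists_isInstance : IsConflict F I C ↔
    ∃ c ∈ F, ∃ fs : List (DBFact S), (∀ f ∈ fs, f ∈ I) ∧ c.IsInstance fs ∧ fs.toFinset = C := by
  constructor
  · rintro ⟨hC, c, hc, ρ, hρ, hcond, fs, hfs, rfl⟩
    exact ⟨c, hc, fs, fun f hf => hC (List.mem_toFinset.2 hf), ⟨ρ, hρ, hcond, hfs⟩, rfl⟩
  · rintro ⟨c, hc, fs, hfI, ⟨ρ, hρ, hcond, hfs⟩, rfl⟩
    exact ⟨fun f hf => hfI f (List.mem_toFinset.1 hf), c, hc, ρ, hρ, hcond, fs, hfs, rfl⟩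

/-- The positions of the variables in the atoms `as` when these are matched with the facts `fs`:
`(v, j, f)` means that the component `j` of `f` is the value of `v`. -/
def variableSlots (as : List (RelAtom S n)) (fs : List (DBFact S)) :
    List (Fin n × ℕ × DBFact S) :=
  (as.zip fs).flatMap fun p => p.1.vars.zipIdx.map fun v => (v.1, v.2, p.2)

/-- The component of a fact at a position, with the default value that programs read. -/
def slotValue (q : ℕ × DBFact S) : Constant := q.2.args.getD q.1 (.num 0)

/-- The substitution that reads the value of each variable at its first slot. -/
def slotSubst (slots : List (Fin n × ℕ × DBFact S)) (v : Fin n) : Constant :=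
  ((slots.lookup v).map slotValue).getD (.num 0)

theorem mem_variableSlots_iff : (v, j, f) ∈ variableSlots as fs ↔
    ∃ a, (a, f) ∈ as.zip fs ∧ a.vars[j]? = some v := by
  simp only [variableSlots, List.mem_flatMap, List.mem_map, Prod.mk.injEq, Prod.exists,
    List.mem_zipIdx_iff_getElem?]
  constructor
  · rintro ⟨a, _, haf, _, _, hv, rfl, rfl, rfl⟩
    exact ⟨a, haf, hv⟩
  · rintro ⟨a, haf, hv⟩
    exact ⟨a, f, haf, v, j, hv, rfl, rfl, rfl⟩

theorem length_variableSlots_le (as : List (RelAtom S n)) (fs : List (DBFact S)) :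
    (variableSlots as fs).length ≤ (as.map fun a => a.vars.length).sum := by
  induction as generalizing fs with
  | nil => simp [variableSlots]
  | cons a as ih =>
    cases fs with
    | nil => simp [variableSlots]
    | cons f fs => simpa [variableSlots] using ih fs

theorem RelAtom.matches_iff {dom : Fin n → Domain} (ha : a.vars.map dom = S.signature a.rel) :
    a.Matches ρ f ↔ f.rel = a.rel ∧ ∀ v j, a.vars[j]? = some v → slotValue (j, f) = ρ v := by
  refine and_congr_right fun hrel => ⟨fun hargs v j hv => by simp [slotValue, hargs, hv],
    fun hval => ?_⟩
  have hlen : f.args.length = a.vars.length := by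
    simpa [hrel, ← ha] using congrArg List.length f.typed
  refine List.ext_getElem (by simpa using hlen) fun j hj hj' => ?_
  have := hval _ j (List.getElem?_eq_getElem (hlen ▸ hj))
  simpa [slotValue, hj] using this

theorem forall₂_matches_iff {dom : Fin n → Domain} (hlen : fs.length = as.length)
    (has : ∀ a ∈ as, a.vars.map dom = S.signature a.rel) :
    List.Forall₂ (fun a f => a.Matches ρ f) as fs ↔
      (∀ p ∈ as.zip fs, p.2.rel = p.1.rel) ∧
        ∀ s ∈ variableSlots as fs, slotValue s.2 = ρ s.1 := by
  rw [List.forall₂_iff_zip]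
  constructor
  · rintro ⟨-, h⟩
    refine ⟨fun p hp => (h hp).1, fun ⟨v, j, f⟩ hs => ?_⟩
    obtain ⟨a, haf, hv⟩ := mem_variableSlots_iff.1 hs
    exact ((a.matches_iff (has a (List.of_mem_zip haf).1)).1 (h haf)).2 v j hv
  · rintro ⟨hrel, hval⟩
    refine ⟨hlen.symm, fun {a f} haf => (a.matches_iff (has a (List.of_mem_zip haf).1)).2
      ⟨hrel _ haf, fun v j hv => hval (v, j, f) (mem_variableSlots_iff.2 ⟨a, haf, hv⟩)⟩⟩

theorem slotValue_eq_slotSubst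
    (h : ∀ s ∈ slots, ∀ t ∈ slots, s.1 = t.1 → slotValue s.2 = slotValue t.2)
    {s : Fin n × ℕ × DBFact S} (hs : s ∈ slots) : slotValue s.2 = slotSubst slots s.1 := by
  obtain ⟨q, hq⟩ := Option.isSome_iff_exists.1
    (List.lookup_isSome_iff.2 ⟨s, hs, beq_self_eq_true s.1⟩)
  obtain ⟨l₁, l₂, hl, -⟩ := List.lookup_eq_some_iff.1 hq
  have hmem : (s.1, q) ∈ slots := by simp [hl]
  rw [slotSubst, hq, Option.map_some, Option.getD_some]
  exact h s hs _ hmem rfl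

theorem slotSubst_eq (h : ∀ s ∈ slots, slotValue s.2 = ρ s.1) (hv : ∃ s ∈ slots, s.1 = v) :
    slotSubst slots v = ρ v := by
  obtain ⟨s, hs, rfl⟩ := hv
  rw [← h s hs, slotValue_eq_slotSubst (fun s hs t ht hst => ?_) hs]
  rw [h s hs, h t ht, hst]

theorem DenialConstraint.exists_mem_variableSlots (hlen : fs.length = c.atoms.length)
    (v : Fin c.nvars) : ∃ s ∈ variableSlots c.atoms fs, s.1 = v := by
  obtain ⟨a, ha, hv⟩ := c.covers v
  rw [← List.map_fst_zip hlen.ge] at ha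
  obtain ⟨⟨a, f⟩, haf, rfl⟩ := List.mem_map.1 ha
  obtain ⟨j, hj⟩ := List.getElem?_of_mem hv
  exact ⟨(v, j, f), mem_variableSlots_iff.2 ⟨a, haf, hj⟩, rfl⟩

theorem DenialConstraint.admissible_of_forall₂_matches {ρ : Fin c.nvars → Constant}
    (h : List.Forall₂ (fun a f => a.Matches ρ f) c.atoms fs) : c.Admissible ρ := by
  intro v
  obtain ⟨a, ha, hv⟩ := c.covers v
  rw [← List.map_fst_zip h.length_eq.le] at ha
  obtain ⟨⟨a, f⟩, haf, rfl⟩ := List.mem_map.1 ha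
  obtain ⟨hrel, hargs⟩ := (List.forall₂_iff_zip.1 h).2 haf
  have htyped := f.typed
  rw [hrel, ← c.atoms_typed a (List.of_mem_zip haf).1, hargs, List.map_map] at htyped
  exact List.map_inj_left.1 htyped v hv

theorem DenialConstraint.isInstance_iff (hlen : fs.length = c.atoms.length) : c.IsInstance fs ↔
    (∀ p ∈ c.atoms.zip fs, p.2.rel = p.1.rel) ∧
      (∀ s ∈ variableSlots c.atoms fs, ∀ t ∈ variableSlots c.atoms fs,
        s.1 = t.1 → slotValue s.2 = slotValue t.2) ∧
      c.cond.Holds (slotSubst (variableSlots c.atoms fs)) := by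
  constructor
  · rintro ⟨ρ, -, hcond, hfs⟩
    obtain ⟨hrel, hval⟩ := (forall₂_matches_iff hlen c.atoms_typed).1 hfs
    have hρ : slotSubst (variableSlots c.atoms fs) = ρ :=
      funext fun v => slotSubst_eq hval (c.exists_mem_variableSlots hlen v)
    exact ⟨hrel, fun s hs t ht hst => by rw [hval s hs, hval t ht, hst], hρ ▸ hcond⟩
  · rintro ⟨hrel, hval, hcond⟩
    have hfs := (forall₂_matches_iff hlen c.atoms_typed).2
      ⟨hrel, fun _ => slotValue_eq_slotSubst hval⟩
    exact ⟨_, c.admissible_of_forall₂_matches hfs, hcond, hfs⟩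

end Instances

/-- The instructions that read the variables at the given slots. -/
def slotPrograms {S : Schema} {n : ℕ} (slots : List (Fin n × ℕ × DBFact S)) :
    List (Fin n × Prog S (Ty.denote S) .const) :=
  slots.map fun s => (s.1, .arg s.2.1 (.var (τ := .fact) s.2.2))

section SlotPrograms

variable {S : Schema} {n : ℕ} {slots : List (Fin n × ℕ × DBFact S)}

theorem lookup_slotPrograms (slots : List (Fin n × ℕ × DBFact S)) (v : Fin n) :
    (slotPrograms slots).lookup v =
      (slots.lookup v).map fun q => .arg q.1 (.var (τ := .fact) q.2) := by
  induction slots with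
  | nil => rfl
  | cons s slots ih =>
    rw [slotPrograms, List.map_cons, List.lookup_cons, List.lookup_cons, ← slotPrograms, ih]
    split <;> rfl

theorem spec_arg_var (j : ℕ) (f : DBFact S) :
    (Prog.arg j (.var (V := Ty.denote S) (τ := .fact) f)).eval.Spec 2 {slotValue (j, f)} :=
  (((Comp.spec_ret f).spend 1).andThen_singleton (f := fun x => .ret (slotValue (j, x)))
    (Comp.spec_ret _)).spend 1

theorem spec_term (slots : List (Fin n × ℕ × DBFact S)) (t : DBTerm n) :
    (Prog.term (slotPrograms slots) t).eval.Spec 2 {t.value (slotSubst slots)} := by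
  have hconst (c : Constant) :
      (Prog.constant (V := Ty.denote S) (S := S) c).eval.Spec 2 {c} :=
    ((Comp.spec_ret c).spend 1).mono one_le_two
  cases t with
  | const c => exact hconst c
  | var v =>
    rw [Prog.term, lookup_slotPrograms, DBTerm.value, slotSubst]
    cases slots.lookup v with
    | none => exact hconst _
    | some q => exact spec_arg_var q.1 q.2

theorem size_slotSubst_le {b : ℕ} (h : ∀ s ∈ slots, s.2.2.size ≤ b) (v : Fin n) :
    (slotSubst slots v).size ≤ b + 2 := by
  rw [slotSubst]
  cases hq : slots.lookup v with
  | none => simp [Constant.size]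
  | some q =>
    obtain ⟨l₁, l₂, hl, -⟩ := List.lookup_eq_some_iff.1 hq
    have hmem : (v, q) ∈ slots := by simp [hl]
    exact (Constant.size_getD_args_le q.2 q.1).trans (Nat.add_le_add_right (h _ hmem) 2)

theorem flatten_zipWith_occurrences (as : List (RelAtom S n)) (fs : List (DBFact S)) :
    (List.zipWith (Prog.occurrences (V := Ty.denote S)) as fs).flatten =
      slotPrograms (variableSlots as fs) := by
  refine (congrArg List.flatten List.map_uncurry_zip_eq_zipWith.symm).trans ?_
  rw [slotPrograms, variableSlots, List.map_flatMap, List.flatMap_def]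
  simp only [List.map_map]
  rfl

theorem product_map_map {α β : Type*} (f : α → β) (l l' : List α) :
    l.map f ×ˢ l'.map f = (l ×ˢ l').map (Prod.map f f) := by
  induction l with
  | nil => rfl
  | cons a l ih => simp [List.product_cons, ih, Function.comp_def]

theorem isInstance_eq (c : DenialConstraint S) (fs : List (DBFact S)) :
    Prog.isInstance (V := Ty.denote S) c fs =
      .and (.all ((c.atoms.zip fs).map fun p => .relIs p.1.rel (.var (τ := .fact) p.2)))
        (.and
          (.all (((variableSlots c.atoms fs ×ˢ variableSlots c.atoms fs).filter
            fun p => p.1.1 = p.2.1).map fun p => .cmp .eq (.arg p.1.2.1 (.var (τ := .fact) p.1.2.2))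
              (.arg p.2.2.1 (.var (τ := .fact) p.2.2.2))))
          (.formula (slotPrograms (variableSlots c.atoms fs)) c.cond)) := by
  unfold Prog.isInstance
  simp only [flatten_zipWith_occurrences]
  conv_lhs => enter [2, 1]; rw [slotPrograms, product_map_map, List.filter_map, List.map_map]
  exact congrArg₂ Prog.and (congrArg Prog.all List.map_uncurry_zip_eq_zipWith.symm) rfl

end SlotPrograms

namespace InputFamily

variable {ι : Type} {P : InputFamily ι} {S : Schema} {B : ι → ℕ}

section Formulas

variable {n : ℕ} {slots : ι → List (Fin n × ℕ × DBFact S)}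

theorem computes_term (slots : ι → List (Fin n × ℕ × DBFact S)) (t : DBTerm n) :
    P.Computes (fun i => .term (slotPrograms (slots i)) t) fun i => t.value (slotSubst (slots i)) :=
  (polyBounded_const 2).polyTime fun i _ => spec_term (slots i) t

theorem polyBounded_size_value (hB : P.PolyBounded B)
    (hsize : ∀ i, P.Valid i → ∀ s ∈ slots i, s.2.2.size ≤ B i) (t : DBTerm n) :
    P.PolyBounded fun i => (t.value (slotSubst (slots i))).size := by
  cases t with
  | const c => exact polyBounded_const c.size
  | var v => exact (hB.add (polyBounded_const 2)).of_le fun i hi => size_slotSubst_le (hsize i hi) v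

theorem decides_formula (hB : P.PolyBounded B)
    (hsize : ∀ i, P.Valid i → ∀ s ∈ slots i, s.2.2.size ≤ B i) (φ : QFFormula n) :
    P.Decides (fun i => .formula (slotPrograms (slots i)) φ)
      fun i => φ.Holds (slotSubst (slots i)) := by
  induction φ with
  | verum => exact (decides_lit true).congr fun _ _ => by simp [QFFormula.Holds]
  | atom op t u =>
    exact Computes.cmp op (computes_term slots t) (computes_term slots u)
      (polyBounded_size_value hB hsize t) (polyBounded_size_value hB hsize u)
  | neg φ ih => exact ih.not
  | and φ ψ ihφ ihψ => exact ihφ.and ihψ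
  | or φ ψ ihφ ihψ => exact ihφ.or ihψ

end Formulas

variable {c : DenialConstraint S} {fs : ι → List (DBFact S)}

theorem decides_relations_eq (hlen : ∀ i, P.Valid i → (fs i).length = c.atoms.length) :
    P.Decides (fun i => .all ((c.atoms.zip (fs i)).map fun p =>
        .relIs p.1.rel (.var (τ := .fact) p.2)))
      fun i => ∀ p ∈ c.atoms.zip (fs i), p.2.rel = p.1.rel :=
  have htest : (P.extend fun i p => p ∈ c.atoms.zip (fs i)).Decides
      (fun q => .relIs q.2.1.rel (.var (τ := .fact) q.2.2)) fun q => q.2.2.rel = q.2.1.rel :=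
    Computes.relIs (fun q : ι × RelAtom S c.nvars × DBFact S => q.2.1.rel)
      (computes_var .fact fun q : ι × RelAtom S c.nvars × DBFact S => q.2.2)
  Decides.all ((polyBounded_const c.atoms.length).of_le fun i hi => by simp [hlen i hi]) htest

theorem decides_slotValues_eq {n : ℕ} {slots : ι → List (Fin n × ℕ × DBFact S)}
    (hB : P.PolyBounded B) (hsize : ∀ i, P.Valid i → ∀ s ∈ slots i, s.2.2.size ≤ B i)
    (hlen : P.PolyBounded fun i => (slots i).length) :
    P.Decides (fun i => .all (((slots i ×ˢ slots i).filter fun p => p.1.1 = p.2.1).map fun p =>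
        .cmp .eq (.arg p.1.2.1 (.var (τ := .fact) p.1.2.2))
          (.arg p.2.2.1 (.var (τ := .fact) p.2.2.2))))
      fun i => ∀ s ∈ slots i, ∀ t ∈ slots i, s.1 = t.1 → slotValue s.2 = slotValue t.2 := by
  let R (i : ι) (p : (Fin n × ℕ × DBFact S) × Fin n × ℕ × DBFact S) : Prop :=
    p ∈ (slots i ×ˢ slots i).filter fun p => p.1.1 = p.2.1
  have hvalue (s : ι × (Fin n × ℕ × DBFact S) × (Fin n × ℕ × DBFact S) → Fin n × ℕ × DBFact S) :
      (P.extend R).Computes (fun q => .arg (s q).2.1 (.var (τ := .fact) (s q).2.2))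
        fun q => slotValue (s q).2 :=
    Computes.arg (fun q => (s q).2.1) (computes_var .fact fun q => (s q).2.2)
  have hbound (s : ι × (Fin n × ℕ × DBFact S) × (Fin n × ℕ × DBFact S) → Fin n × ℕ × DBFact S)
      (hs : ∀ q, (P.extend R).Valid q → s q ∈ slots q.1) :
      (P.extend R).PolyBounded fun q => (slotValue (s q).2).size :=
    ((hB.add (polyBounded_const 2)).extend R).of_le fun q hq =>
      (Constant.size_getD_args_le _ _).trans
        (Nat.add_le_add_right (hsize q.1 hq.1 (s q) (hs q hq)) 2)
  have htest : (P.extend R).Decides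
      (fun q => .cmp .eq (.arg q.2.1.2.1 (.var (τ := .fact) q.2.1.2.2))
        (.arg q.2.2.2.1 (.var (τ := .fact) q.2.2.2.2)))
      fun q => slotValue q.2.1.2 = slotValue q.2.2.2 :=
    Computes.cmp .eq (hvalue fun q => q.2.1) (hvalue fun q => q.2.2)
      (hbound _ fun q hq => (List.mem_product.1 (List.mem_of_mem_filter hq.2)).1)
      (hbound _ fun q hq => (List.mem_product.1 (List.mem_of_mem_filter hq.2)).2)
  have hpairs : P.PolyBounded fun i =>
      ((slots i ×ˢ slots i).filter fun p => p.1.1 = p.2.1).length :=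
    (hlen.mul hlen).of_le fun i _ =>
      (List.length_filter_le _ _).trans (List.length_product _ _).le
  refine (Decides.all hpairs htest).congr fun i _ => ⟨fun h s hs t ht hst => ?_, fun h p hp => ?_⟩
  · exact h (s, t) (List.mem_filter.2 ⟨List.mem_product.2 ⟨hs, ht⟩, decide_eq_true hst⟩)
  · obtain ⟨hmem, heq⟩ := List.mem_filter.1 hp
    exact h _ (List.mem_product.1 hmem).1 _ (List.mem_product.1 hmem).2 (of_decide_eq_true heq)

theorem decides_isInstance (hB : P.PolyBounded B)
    (hlen : ∀ i, P.Valid i → (fs i).length = c.atoms.length)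
    (hsize : ∀ i, P.Valid i → ∀ f ∈ fs i, f.size ≤ B i) :
    P.Decides (fun i => .isInstance c (fs i)) fun i => c.IsInstance (fs i) := by
  have hslots : ∀ i, P.Valid i → ∀ s ∈ variableSlots c.atoms (fs i), s.2.2.size ≤ B i := by
    rintro i hi ⟨v, j, f⟩ hs
    obtain ⟨a, haf, -⟩ := mem_variableSlots_iff.1 hs
    exact hsize i hi f (List.of_mem_zip haf).2
  have hslotsLen : P.PolyBounded fun i => (variableSlots c.atoms (fs i)).length :=
    (polyBounded_const _).of_le fun i _ => length_variableSlots_le c.atoms (fs i)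
  simp only [isInstance_eq]
  exact ((decides_relations_eq hlen).and ((decides_slotValues_eq hB hslots hslotsLen).and
    (decides_formula hB hslots c.cond))).congr fun i hi => (c.isInstance_iff (hlen i hi)).symm

end InputFamily

/-! ## Programs on instances and priorities -/

open Classical in
/-- The list version of `accept`. -/
noncomputable def acceptList {S : Schema} (F : List (DenialConstraint S))
    (J : List (DBFact S)) (x : DBFact S) : List (DBFact S) :=
  if Consistent F (x :: J).toFinset then x :: J else J

namespace InputFamily

variable {S : Schema} {F : List (DenialConstraint S)}

section Conflicts

theorem decides_existsTuple (n : ℕ) {ι : Type} {P : InputFamily ι} {l : ι → List (DBFact S)}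
    {test : ι × List (DBFact S) → Prog S (Ty.denote S) .bool} {T : ι × List (DBFact S) → Prop}
    (hlen : P.PolyBounded fun i => (l i).length)
    (htest : (P.extend fun i fs => (∀ f ∈ fs, f ∈ l i) ∧ fs.length = n).Decides test T) :
    P.Decides (fun i => .existsTuple (l i) n fun fs => test (i, fs))
      fun i => ∃ fs, ((∀ f ∈ fs, f ∈ l i) ∧ fs.length = n) ∧ T (i, fs) := by
  induction n generalizing ι with
  | zero =>
    have h : P.Decides (fun i => test (i, [])) fun i => T (i, []) :=
      PolyTime.comp htest (fun i => (i, [])) (fun i hi => ⟨hi, by simp⟩) fun _ => rfl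
    exact h.congr fun i _ => by simp only [List.length_eq_zero_iff]; aesop
  | succ n ih =>
    have hcons : ((P.extend fun i f => f ∈ l i).extend
        fun q fs => (∀ f ∈ fs, f ∈ l q.1) ∧ fs.length = n).Decides
        (fun q => test (q.1.1, q.1.2 :: q.2)) fun q => T (q.1.1, q.1.2 :: q.2) :=
      PolyTime.comp htest
        (fun q : (ι × DBFact S) × List (DBFact S) => (q.1.1, q.1.2 :: q.2))
        (fun q hq => ⟨hq.1.1, List.forall_mem_cons.2 ⟨hq.1.2, hq.2.1⟩, congrArg (· + 1) hq.2.2⟩)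
        fun _ => rfl
    have hinner := ih (hlen.extend fun i f => f ∈ l i) hcons
    refine ((computes_var (.list .fact) l).existsIn hlen hinner).congr fun i _ => ⟨?_, ?_⟩
    · rintro ⟨f, hf, fs, ⟨hfs, hn⟩, hT⟩
      exact ⟨f :: fs, ⟨List.forall_mem_cons.2 ⟨hf, hfs⟩, congrArg (· + 1) hn⟩, hT⟩
    · rintro ⟨fs, ⟨hfs, hn⟩, hT⟩
      obtain ⟨f, fs, rfl⟩ := List.exists_cons_of_length_eq_add_one hn
      exact ⟨f, hfs f List.mem_cons_self, fs,
        ⟨fun g hg => hfs g (List.mem_cons_of_mem f hg), by simpa using hn⟩, hT⟩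

variable {ι : Type} {P : InputFamily ι} {l : ι → List (DBFact S)}

theorem decides_existsConflict {test : ι × List (DBFact S) → Prog S (Ty.denote S) .bool}
    {U : ι → DBInstance S → Prop} (hl : P.PolyBounded fun i => totalSize (l i))
    (htest : ∀ n, (P.extend fun i fs => (∀ f ∈ fs, f ∈ l i) ∧ fs.length = n).Decides test
      fun q => U q.1 q.2.toFinset) :
    P.Decides (fun i => .existsConflict F (l i) fun fs => test (i, fs))
      fun i => ∃ C, IsConflict F (l i).toFinset C ∧ U i C := by
  have hc (c : DenialConstraint S) (_ : c ∈ F) := decides_existsTuple c.atoms.length hl.length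
    ((decides_isInstance (c := c) (fs := fun q : ι × List (DBFact S) => q.2) (hl.extend _)
      (fun q hq => hq.2.2) fun q hq f hf => size_le_totalSize (hq.2.1 f hf)).and
      (htest c.atoms.length))
  refine (decides_any_map hc).congr fun i _ => ⟨?_, ?_⟩
  · rintro ⟨c, hc, fs, ⟨hfs, -⟩, hinst, hU⟩
    exact ⟨_, isConflict_iff_exists_isInstance.2
      ⟨c, hc, fs, fun f hf => List.mem_toFinset.2 (hfs f hf), hinst, rfl⟩, hU⟩
  · rintro ⟨C, hC, hU⟩
    obtain ⟨c, hc, fs, hfs, hinst, rfl⟩ := isConflict_iff_exists_isInstance.1 hC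
    obtain ⟨ρ, -, -, hmatch⟩ := id hinst
    exact ⟨c, hc, fs, ⟨fun f hf => List.mem_toFinset.1 (hfs f hf), hmatch.length_eq.symm⟩,
      hinst, hU⟩

theorem decides_consistent (hl : P.PolyBounded fun i => totalSize (l i)) :
    P.Decides (fun i => .consistent F (l i)) fun i => Consistent F (l i).toFinset := by
  have h := decides_existsConflict (F := F) (U := fun _ _ => true = true) hl fun n =>
    decides_lit true
  exact h.not.congr fun i _ => by simp [consistent_iff_forall_not_isConflict]

end Conflicts

variable {ι : Type} {P : InputFamily ι} {x : ι → DBFact S}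
  {l J K : ι → List (DBFact S)} {prio : ι → List (DBFact S × DBFact S)}

theorem computes_addIfConsistent (hx : P.PolyBounded fun i => (x i).size)
    (hJ : P.PolyBounded fun i => totalSize (J i)) :
    P.Computes (fun i => .addIfConsistent F (x i) (J i)) fun i => acceptList F (J i) (x i) := by
  classical
  have hxJ : P.PolyBounded fun i => totalSize (x i :: J i) := by
    simpa only [totalSize_cons] using hx.add hJ
  exact ((computes_var .fact x).cons (computes_var (.list .fact) J)).bind
    ((decides_consistent hxJ).computes_ite (computes_var (.list .fact) fun i => x i :: J i)
      (computes_var (.list .fact) J))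

open Classical in
theorem computes_winnow (hl : P.PolyBounded fun i => totalSize (l i))
    (hprio : P.PolyBounded fun i => ((prio i).map fun q => q.1.size + q.2.size).sum) :
    P.Computes (fun i => .winnow (prio i) (l i))
      fun i => ((l i).filter fun x => ¬ ∃ y ∈ l i, (y, x) ∈ prio i).reverse := by
  have hdom := decides_dominates (x := fun q : (ι × DBFact S) × DBFact S => q.2)
    (hl.extend fun i x => x ∈ l i).size_of_mem (hl.size_of_mem.extend _)
    ((hprio.extend _).extend _)
  have hsome := (computes_var (.list .fact) fun q : ι × DBFact S => l q.1).existsIn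
    (hl.length.extend fun i x => x ∈ l i) hdom
  exact ((computes_var (.list .fact) l).filter hl.length hsome.not).congr fun i _ =>
    congrArg List.reverse (List.filter_congr fun _ _ => decide_eq_decide.2 Iff.rfl)

theorem decides_existsConflict_not_dominates (hy : P.PolyBounded fun i => (x i).size)
    (hl : P.PolyBounded fun i => totalSize (l i))
    (hprio : P.PolyBounded fun i => ((prio i).map fun q => q.1.size + q.2.size).sum) :
    P.Decides
      (fun i => .existsConflict F (l i) fun fs =>
        .not (.any (fs.map fun y => .dominates (prio i) (x i) y)))
      fun i => ∃ C, IsConflict F (l i).toFinset C ∧ ∀ y ∈ C, (x i, y) ∉ prio i := by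
  let R (n : ℕ) (i : ι) (fs : List (DBFact S)) : Prop := (∀ f ∈ fs, f ∈ l i) ∧ fs.length = n
  have htest (n : ℕ) : (P.extend (R n)).Decides
      (fun q => .not (.any (q.2.map fun y => .dominates (prio q.1) (x q.1) y)))
      fun q => ∀ y ∈ q.2.toFinset, (x q.1, y) ∉ prio q.1 := by
    have hfs : ((P.extend (R n)).extend fun q y => y ∈ q.2).PolyBounded fun q => q.2.size :=
      ((hl.extend (R n)).extend _).of_le fun q hq => size_le_totalSize (hq.1.2.1 q.2 hq.2)
    have hdom := decides_dominates ((hy.extend (R n)).extend _) hfs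
      ((hprio.extend (R n)).extend _)
    have hlen : (P.extend (R n)).PolyBounded fun q => q.2.length :=
      (polyBounded_const n).of_le fun q hq => hq.2.2.le
    exact (Decides.any hlen hdom).not.congr fun q _ => by simp
  exact decides_existsConflict (U := fun i C => ∀ y ∈ C, (x i, y) ∉ prio i) hl htest

theorem decides_isParetoOptimal (hl : P.PolyBounded fun i => totalSize (l i))
    (hK : P.PolyBounded fun i => totalSize (K i))
    (hprio : P.PolyBounded fun i => ((prio i).map fun q => q.1.size + q.2.size).sum) :
    P.Decides (fun i => .isParetoOptimal F (l i) (prio i) (K i))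
      fun i => ∀ y ∈ l i, y ∉ K i →
        ∃ C, IsConflict F (insert y (K i).toFinset) C ∧ ∀ x ∈ C, (y, x) ∉ prio i := by
  let Q := P.extend fun i y => y ∈ l i
  have hyK : Q.PolyBounded fun q => totalSize (q.2 :: K q.1) := by
    simpa only [totalSize_cons] using hl.size_of_mem.add (hK.extend fun i y => y ∈ l i)
  have hnew : Q.Decides (fun q => .not (.mem q.2 (K q.1))) fun q => q.2 ∉ K q.1 :=
    (decides_mem hl.size_of_mem (hK.extend _)).not
  have hblocked := (decides_existsConflict_not_dominates (F := F) hl.size_of_mem hyK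
    (hprio.extend fun i y => y ∈ l i)).not
  simp only [List.toFinset_cons] at hblocked
  have hfree := ((computes_var .fact fun q : ι × DBFact S => q.2).cons
    (computes_var (.list .fact) fun q : ι × DBFact S => K q.1)).bind
    (k := fun (q : ι × DBFact S) L => .not (.existsConflict F L fun fs =>
      .not (.any (fs.map fun x => .dominates (prio q.1) q.2 x)))) hblocked
  refine ((computes_var (.list .fact) l).existsIn hl.length (hnew.and hfree)).not.congr
    fun i _ => not_exists.trans (forall_congr' fun y => ?_)
  exact not_and.trans (forall_congr' fun _ => not_and.trans (forall_congr' fun _ => not_not))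

end InputFamily

/-! ## The greedy loops -/

section GreedyLoop

variable {S : Schema} {F : List (DenialConstraint S)} {r : DBFact S → DBFact S → Prop}
  {pick : List (DBFact S) → List (DBFact S)} {s : List (DBFact S) × List (DBFact S)}
  {K : DBInstance S}

/-- The possible effects of one round of a greedy loop that chooses the next fact from the list
`pick l`, where `l` lists the facts not yet considered. The first component of a state is this
list, the second one lists the facts accepted so far. -/
def greedyStep (F : List (DenialConstraint S)) (pick : List (DBFact S) → List (DBFact S))
    (s : List (DBFact S) × List (DBFact S)) : Set (List (DBFact S) × List (DBFact S)) :=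
  {s' | ∃ x ∈ pick s.1, s' = ((s.1.filter (· ≠ x)).reverse, acceptList F s.2 x)}

theorem toFinset_acceptList (J : List (DBFact S)) (x : DBFact S) :
    (acceptList F J x).toFinset = accept F J.toFinset x := by
  unfold acceptList accept
  rw [List.toFinset_cons]
  split_ifs
  exacts [List.toFinset_cons, rfl]

theorem toFinset_reverse_filter_ne (l : List (DBFact S)) (x : DBFact S) :
    (l.filter (· ≠ x)).reverse.toFinset = l.toFinset.erase x := by
  ext y
  simp [and_comm]

theorem totalSize_acceptList_le (J : List (DBFact S)) (x : DBFact S) :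
    totalSize (acceptList F J x) ≤ x.size + totalSize J := by
  unfold acceptList
  split_ifs <;> simp

theorem totalSize_greedyStep_le (hpick : ∀ x ∈ pick s.1, x ∈ s.1) {s'}
    (hs' : s' ∈ greedyStep F pick s) :
    totalSize s'.1 + totalSize s'.2 ≤ totalSize s.1 + totalSize s.2 := by
  obtain ⟨x, hx, rfl⟩ := hs'
  have hrest := totalSize_filter_ne_add_size_le (hpick x hx)
  have haccepted := totalSize_acceptList_le (F := F) s.2 x
  simp only [totalSize_reverse]
  omega

theorem totalSize_le_of_reaches (hpick : ∀ l, ∀ x ∈ pick l, x ∈ l) {t}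
    (ht : Comp.Reaches (fun s => pick s.1 ≠ []) (greedyStep F pick) s t) :
    totalSize t.2 ≤ totalSize s.1 + totalSize s.2 := by
  induction ht with
  | done => exact Nat.le_add_left _ _
  | @next s _ _ _ hs' _ ih => exact ih.trans (totalSize_greedyStep_le (hpick s.1) hs')

theorem length_greedyStep_lt (hpick : ∀ x ∈ pick s.1, x ∈ s.1) {s'}
    (hs' : s' ∈ greedyStep F pick s) : s'.1.length < s.1.length := by
  obtain ⟨x, hx, rfl⟩ := hs'
  rw [List.length_reverse, List.length_filter_lt_length_iff_exists]
  exact ⟨x, hpick x hx, by simp⟩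

variable (hpick : ∀ l x, x ∈ pick l ↔ x ∈ l ∧ ∀ y ∈ l, ¬ r y x)
include hpick

theorem exists_isChoiceSequence_of_reaches (hr : ∀ x, ¬ Relation.TransGen r x x) {t}
    (ht : Comp.Reaches (fun s => pick s.1 ≠ []) (greedyStep F pick) s t) :
    ∃ l, IsChoiceSequence r s.1.toFinset l ∧ l.foldl (accept F) s.2.toFinset = t.2.toFinset := by
  induction ht with
  | @done s hs =>
    refine ⟨[], isChoiceSequence_nil.2 ?_, rfl⟩
    by_contra hne
    obtain ⟨x, hx, hmin⟩ := exists_mem_forall_not_transGen hr (Finset.nonempty_iff_ne_empty.2 hne)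
    have hxs : x ∈ pick s.1 := (hpick s.1 x).2
      ⟨List.mem_toFinset.1 hx, fun y hy hyx => hmin y (List.mem_toFinset.2 hy) (.single hyx)⟩
    exact hs (List.ne_nil_of_mem hxs)
  | @next s s' t _ hs' _ ih =>
    obtain ⟨x, hx, rfl⟩ := hs'
    obtain ⟨l, hl, ht⟩ := ih
    obtain ⟨hxs, hmin⟩ := (hpick s.1 x).1 hx
    rw [toFinset_reverse_filter_ne] at hl
    rw [toFinset_acceptList] at ht
    exact ⟨x :: l, (isChoiceSequence_cons fun h => hr x (.single h)).2
      ⟨List.mem_toFinset.2 hxs, fun y hy => hmin y (List.mem_toFinset.1 hy), hl⟩, ht⟩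

theorem exists_reaches_of_isChoiceSequence (hr : ∀ x, ¬ r x x) {l : List (DBFact S)}
    (hl : IsChoiceSequence r s.1.toFinset l) :
    ∃ t, Comp.Reaches (fun s => pick s.1 ≠ []) (greedyStep F pick) s t ∧
      t.2.toFinset = l.foldl (accept F) s.2.toFinset := by
  induction l generalizing s with
  | nil =>
    have hs : s.1 = [] := List.toFinset_eq_empty_iff _ |>.1 (isChoiceSequence_nil.1 hl)
    have hempty : pick s.1 = [] := List.eq_nil_iff_forall_not_mem.2 fun x hx => by
      simpa [hs] using ((hpick s.1 x).1 hx).1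
    exact ⟨s, .done (not_not.2 hempty), rfl⟩
  | cons x l ih =>
    obtain ⟨hx, hmin, hl⟩ := (isChoiceSequence_cons (hr x)).1 hl
    have hxs : x ∈ pick s.1 := (hpick s.1 x).2
      ⟨List.mem_toFinset.1 hx, fun y hy => hmin y (List.mem_toFinset.2 hy)⟩
    rw [← toFinset_reverse_filter_ne] at hl
    obtain ⟨t, ht, hK⟩ := ih (s := ((s.1.filter (· ≠ x)).reverse, acceptList F s.2 x)) hl
    rw [toFinset_acceptList] at hK
    exact ⟨t, .next (List.ne_nil_of_mem hxs) ⟨x, hxs, rfl⟩ ht, hK⟩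

theorem exists_reaches_greedyStep_iff (hr : ∀ x, ¬ Relation.TransGen r x x)
    {I : List (DBFact S)} :
    (∃ t, Comp.Reaches (fun s => pick s.1 ≠ []) (greedyStep F pick) (I, []) t ∧
        t.2.toFinset = K) ↔
      ∃ l, IsChoiceSequence r I.toFinset l ∧ greedyRepair F l = K := by
  constructor
  · rintro ⟨t, ht, rfl⟩
    exact exists_isChoiceSequence_of_reaches hpick hr ht
  · rintro ⟨l, hl, rfl⟩
    exact exists_reaches_of_isChoiceSequence hpick (fun x h => hr x (.single h))
      (s := (I, [])) hl

end GreedyLoop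

namespace Prog

variable {S : Schema} {V : Ty → Type}

/-- The body that the loops of `constructRepair` and `constructCommonOptimalRepair` share;
`choices Io` lists the facts among which the next one is chosen. -/
def greedyRound (F : List (DenialConstraint S))
    (choices : V (.list .fact) → Prog S V (.list .fact))
    (s : V (.prod (.list .fact) (.list .fact))) : Prog S V (.prod (.list .fact) (.list .fact)) :=
  bind (fst (var s)) fun Io => bind (snd (var s)) fun J =>
    bind (choose (choices Io)) fun x => pair (remove x Io) (addIfConsistent F x J)

/-- The common form of `constructRepair` and `constructCommonOptimalRepair`. -/
def greedyLoop (F : List (DenialConstraint S))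
    (cond : V (.prod (.list .fact) (.list .fact)) → Prog S V .bool)
    (choices : V (.list .fact) → Prog S V (.list .fact)) (I : V (.list .fact)) :
    Prog S V (.list .fact) :=
  snd (whileDo (pair (var I) nil) cond (greedyRound F choices))

end Prog

namespace InputFamily

variable {ι : Type} {P : InputFamily ι} {S : Schema} {F : List (DenialConstraint S)}
  {I : ι → List (DBFact S)} {prio : ι → List (DBFact S × DBFact S)}
  {e : ι → Prog S (Ty.denote S) (.list .fact)} {𝒦 : ι → Set (DBInstance S)}

/-- The programs `e i` run in polynomial time on the inputs of `P`, the results of their runs are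
lists of polynomially bounded size, and the instances that they list are exactly the elements
of `𝒦 i`. -/
def Produces (P : InputFamily ι) (e : ι → Prog S (Ty.denote S) (.list .fact))
    (𝒦 : ι → Set (DBInstance S)) : Prop :=
  ∃ A : ι → Set (List (DBFact S)), P.PolyTime e A ∧
    (P.extend fun i l => l ∈ A i).PolyBounded (fun q => totalSize q.2) ∧
    ∀ i, P.Valid i → ∀ K, (∃ l ∈ A i, l.toFinset = K) ↔ K ∈ 𝒦 i

theorem Produces.congr {𝓛 : ι → Set (DBInstance S)} (h : P.Produces e 𝒦)
    (h𝒦 : ∀ i, P.Valid i → ∀ K, K ∈ 𝒦 i ↔ K ∈ 𝓛 i) : P.Produces e 𝓛 :=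
  h.imp fun _ ⟨hA, hsize, hA𝒦⟩ => ⟨hA, hsize, fun i hi K => (hA𝒦 i hi K).trans (h𝒦 i hi K)⟩

theorem polyTime_greedyRound {t : ι → List (DBFact S) × List (DBFact S)}
    {choices : ι → List (DBFact S) → Prog S (Ty.denote S) (.list .fact)}
    {pick : ι → List (DBFact S) → List (DBFact S)}
    (ht : P.PolyBounded fun i => totalSize (t i).1 + totalSize (t i).2)
    (hchoices : P.Computes (fun i => choices i (t i).1) fun i => pick i (t i).1)
    (hpick : ∀ i, ∀ x ∈ pick i (t i).1, x ∈ (t i).1)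
    (hne : ∀ i, P.Valid i → pick i (t i).1 ≠ [])
    (hlen : P.PolyBounded fun i => (pick i (t i).1).length) :
    P.PolyTime (fun i => .greedyRound F (choices i) (t i))
      fun i => greedyStep F (pick i) (t i) := by
  have hIo : P.PolyBounded fun i => totalSize (t i).1 := ht.of_le fun _ _ => Nat.le_add_right _ _
  have hJ : P.PolyBounded fun i => totalSize (t i).2 := ht.of_le fun _ _ => Nat.le_add_left _ _
  have hx : (P.extend fun i x => x ∈ pick i (t i).1).PolyBounded fun q => q.2.size :=
    (hIo.extend _).of_le fun q hq => size_le_totalSize (hpick q.1 q.2 hq.2)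
  have hstate := computes_var (P := P) (.prod (.list .fact) (.list .fact)) t
  have hnext := (computes_remove hx (hIo.extend _)).pair
    (computes_addIfConsistent (F := F) hx (hJ.extend _))
  exact hstate.fst.bind (hstate.snd.bind ((hchoices.choose hne hlen).bind hnext))

theorem produces_greedyLoop
    {r : ι → DBFact S → DBFact S → Prop}
    {cond : ι → List (DBFact S) × List (DBFact S) → Prog S (Ty.denote S) .bool}
    {choices : ι → List (DBFact S) → Prog S (Ty.denote S) (.list .fact)}
    {pick : ι → List (DBFact S) → List (DBFact S)}
    (hr : ∀ i, P.Valid i → ∀ x, ¬ Relation.TransGen (r i) x x)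
    (hpick : ∀ i l x, x ∈ pick i l ↔ x ∈ l ∧ ∀ y ∈ l, ¬ r i y x)
    (hlen : ∀ i l, (pick i l).length ≤ l.length)
    (hI : P.PolyBounded fun i => totalSize (I i))
    (hcond : (P.extend fun i s => totalSize s.1 + totalSize s.2 ≤ totalSize (I i)).Decides
      (fun q => cond q.1 q.2) fun q => pick q.1 q.2.1 ≠ [])
    (hchoices : (P.extend fun i l => totalSize l ≤ totalSize (I i)).Computes
      (fun q => choices q.1 q.2) fun q => pick q.1 q.2) :
    P.Produces (fun i => .greedyLoop F (cond i) (choices i) (I i))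
      fun i => {K | ∃ l, IsChoiceSequence (r i) (I i).toFinset l ∧ greedyRepair F l = K} := by
  let Inv (i : ι) (s : List (DBFact S) × List (DBFact S)) : Prop :=
    totalSize s.1 + totalSize s.2 ≤ totalSize (I i)
  let Q := P.extend fun i s => Inv i s ∧ pick i s.1 ≠ []
  have hsub (i : ι) (l : List (DBFact S)) : ∀ x ∈ pick i l, x ∈ l := fun x hx =>
    ((hpick i l x).1 hx).1
  have hsize : Q.PolyBounded fun q => totalSize q.2.1 + totalSize q.2.2 :=
    (hI.extend _).of_le fun q hq => hq.2.1
  have hbody : Q.PolyTime (fun q => .greedyRound F (choices q.1) q.2)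
      fun q => greedyStep F (pick q.1) q.2 :=
    polyTime_greedyRound hsize
      (hchoices.comp (fun q : ι × List (DBFact S) × List (DBFact S) => (q.1, q.2.1))
        (fun q hq => ⟨hq.1, (Nat.le_add_right _ _).trans hq.2.1⟩) fun _ => rfl)
      (fun q => hsub q.1 q.2.1) (fun q hq => hq.2.2)
      ((hsize.of_le fun q _ => Nat.le_add_right _ _).length.of_le fun q _ => hlen q.1 q.2.1)
  have hinit : P.Computes (τ := .prod (.list .fact) (.list .fact))
      (fun i => .pair (.var (I i)) .nil) fun i => (I i, []) :=
    (computes_var (.list .fact) I).pair computes_nil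
  have hloop := hinit.whileDo (S := S) (τ := .prod (.list .fact) (.list .fact)) (Inv := Inv)
    (C := fun q : ι × List (DBFact S) × List (DBFact S) => pick q.1 q.2.1 ≠ [])
    (step := fun q : ι × List (DBFact S) × List (DBFact S) => greedyStep F (pick q.1) q.2)
    (μ := fun s : List (DBFact S) × List (DBFact S) => s.1.length)
    (fun i _ => (le_refl (totalSize (I i)) : Inv i (I i, []))) hI.length hcond hbody
    fun i _ s hs _ s' hs' =>
      ⟨(totalSize_greedyStep_le (hsub i s.1) hs').trans hs, length_greedyStep_lt (hsub i s.1) hs'⟩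
  refine ⟨_, hloop.snd, (hI.extend _).of_le ?_, fun i hi K => ?_⟩
  · rintro q ⟨-, t, ht, hqt⟩
    exact hqt ▸ totalSize_le_of_reaches (hsub q.1) ht
  · refine Iff.trans ?_ (exists_reaches_greedyStep_iff (hpick i) (hr i hi))
    exact ⟨fun ⟨_, ⟨t, ht, hl⟩, hK⟩ => ⟨t, ht, hl ▸ hK⟩, fun ⟨t, ht, hK⟩ => ⟨_, ⟨t, ht, rfl⟩, hK⟩⟩

theorem computes_fst_var {σ τ : Ty} {t : ι → Ty.denote S (.prod σ τ)} :
    P.Computes (fun i => .fst (.var (t i))) fun i => (t i).1 :=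
  (computes_var (.prod σ τ) t).fst

theorem produces_constructRepair (hI : P.PolyBounded fun i => totalSize (I i)) :
    P.Produces (fun i => .constructRepair F (I i)) fun i => Repairs F (I i).toFinset := by
  have h := produces_greedyLoop (F := F) (r := fun _ _ _ => False) (pick := fun _ l => l)
    (cond := fun _ s => .not (.isNil (.fst (.var (τ := .prod (.list .fact) (.list .fact)) s))))
    (choices := fun _ Io => .var (τ := .list .fact) Io)
    (fun _ _ => not_transGen_self_of_lt (f := fun _ => 0) fun _ _ => False.elim) (by simp)
    (fun _ _ => le_rfl) hI computes_fst_var.isNil.not (computes_var (.list .fact) _)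
  exact h.congr fun i _ K => mem_repairs_iff_exists_greedyRepair.symm

theorem produces_constructCommonOptimalRepair
    (hr : ∀ i, P.Valid i → IsPriority F (I i).toFinset fun x y => (x, y) ∈ prio i)
    (hI : P.PolyBounded fun i => totalSize (I i))
    (hprio : P.PolyBounded fun i => ((prio i).map fun q => q.1.size + q.2.size).sum) :
    P.Produces (fun i => .constructCommonOptimalRepair F (I i) (prio i))
      fun i => CommonRepairs F (I i).toFinset fun x y => (x, y) ∈ prio i := by
  classical
  have hcond := computes_winnow
    (P := P.extend fun i (s : List (DBFact S) × List (DBFact S)) =>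
      totalSize s.1 + totalSize s.2 ≤ totalSize (I i))
    ((hI.extend _).of_le fun q hq => (Nat.le_add_right _ _).trans hq.2) (hprio.extend _)
  have hchoices := computes_winnow (P := P.extend fun i l => totalSize l ≤ totalSize (I i))
    ((hI.extend _).of_le fun q hq => hq.2) (hprio.extend _)
  have h := produces_greedyLoop (F := F) (r := fun i x y => (x, y) ∈ prio i)
    (cond := fun i s => .bind (.fst (.var (τ := .prod (.list .fact) (.list .fact)) s)) fun Io =>
      .not (.isNil (.winnow (prio i) Io)))
    (choices := fun i Io => .winnow (prio i) Io)
    (pick := fun i l => (l.filter fun x => ¬ ∃ y ∈ l, (y, x) ∈ prio i).reverse)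
    (fun i hi => (hr i hi).acyclic) (by simp)
    (fun i l => by rw [List.length_reverse]; exact List.length_filter_le _ _) hI
    (computes_fst_var.bind hcond.isNil.not) hchoices
  exact h.congr fun i hi K => (mem_commonRepairs_iff_exists_greedyRepair (hr i hi)).symm

section Pareto

variable (hr : ∀ i, P.Valid i → IsPriority F (I i).toFinset fun x y => (x, y) ∈ prio i)
  (hI : P.PolyBounded fun i => totalSize (I i))
  (hprio : P.PolyBounded fun i => ((prio i).map fun q => q.1.size + q.2.size).sum)
include hr hI hprio

theorem decides_paretoOptimal {K : ι → List (DBFact S)}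
    (hK : P.PolyBounded fun i => totalSize (K i))
    (hrep : ∀ i, P.Valid i → (K i).toFinset ∈ Repairs F (I i).toFinset) :
    P.Decides (fun i => .isParetoOptimal F (I i) (prio i) (K i))
      fun i => ParetoOptimal F (I i).toFinset (fun x y => (x, y) ∈ prio i) (K i).toFinset :=
  (decides_isParetoOptimal hI hK hprio).congr fun i hi => by
    have h := paretoOptimal_iff_forall_exists_isConflict (r := fun x y => (x, y) ∈ prio i)
      (hr i hi).irrefl (hrep i hi)
    simpa only [List.mem_toFinset] using h.symm

theorem produces_constructParetoOptimalRepair :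
    P.Produces (fun i => .constructParetoOptimalRepair F (I i) (prio i))
      fun i => ParetoRepairs F (I i).toFinset fun x y => (x, y) ∈ prio i := by
  classical
  obtain ⟨A, hA, ⟨p, hp⟩, hArep⟩ := produces_constructRepair (F := F) hI
  obtain ⟨B, hB, ⟨q, hq⟩, hBcommon⟩ := produces_constructCommonOptimalRepair hr hI hprio
  let Opt (i : ι) (l : List (DBFact S)) : Prop :=
    ParetoOptimal F (I i).toFinset (fun x y => (x, y) ∈ prio i) l.toFinset
  have htest : (P.extend fun i l => l ∈ A i).Decides
      (fun q => .isParetoOptimal F (I q.1) (prio q.1) q.2) fun q => Opt q.1 q.2 :=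
    decides_paretoOptimal (P := P.extend fun i l => l ∈ A i) (fun q hq => hr q.1 hq.1)
      (hI.extend _) (hprio.extend _) ⟨p, hp⟩ fun q hq => (hArep q.1 hq.1 _).1 ⟨q.2, hq.2, rfl⟩
  have hprog := hA.bind (htest.ite (computes_var (.list .fact) Prod.snd)
    (hB.comp Prod.fst (fun _ hs => hs.1) fun _ => rfl))
  have hresult (i : ι) (l : List (DBFact S))
      (hl : ∃ a ∈ A i, l ∈ if Opt i a then ({a} : Set (List (DBFact S))) else B i) :
      l ∈ A i ∧ Opt i l ∨ l ∈ B i := by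
    obtain ⟨a, ha, hl⟩ := hl
    split_ifs at hl with hopt
    · obtain rfl := hl
      exact .inl ⟨ha, hopt⟩
    · exact .inr hl
  refine ⟨_, hprog, ⟨p + q, fun s hs => ?_⟩, fun i hi K => ⟨?_, fun hK => ?_⟩⟩
  · rw [Polynomial.eval_add]
    rcases hresult s.1 s.2 hs.2 with hl | hl
    · exact (hp s ⟨hs.1, hl.1⟩).trans (Nat.le_add_right _ _)
    · exact (hq s ⟨hs.1, hl⟩).trans (Nat.le_add_left _ _)
  · rintro ⟨l, hl, rfl⟩
    rcases hresult i l hl with ⟨hlA, hopt⟩ | hlB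
    · exact ⟨(hArep i hi _).1 ⟨l, hlA, rfl⟩, hopt⟩
    · exact commonRepairs_subset_paretoRepairs ((hBcommon i hi _).1 ⟨l, hlB, rfl⟩)
  · obtain ⟨a, ha, rfl⟩ := (hArep i hi K).2 hK.1
    have hopt : Opt i a := hK.2
    exact ⟨a, ⟨a, ha, show a ∈ if Opt i a then ({a} : Set (List (DBFact S))) else B i from
      if_pos hopt ▸ rfl⟩, rfl⟩

end Pareto

end InputFamily

namespace InputFamily

variable {ι : Type} {P : InputFamily ι} {S : Schema} {F : List (DenialConstraint S)}

theorem Produces.exists_polynomial {e : ι → Prog S (Ty.denote S) (.list .fact)}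
    {𝒦 : ι → Set (DBInstance S)} (h : P.Produces e 𝒦) :
    ∃ p : Polynomial ℕ, ∀ i, P.Valid i → ∀ b, p.eval (P.size i) ≤ b →
      ProducesExactly (e i) b (𝒦 i) :=
  have ⟨_, ⟨p, hp⟩, _, hA𝒦⟩ := h
  ⟨p, fun i hi b hb => ⟨(hp i hi).haltsWithin hb,
    Set.ext fun K => by rw [← hA𝒦 i hi K, ← (hp i hi).results_eq hb]; rfl⟩⟩

theorem Decides.exists_polynomial {c : ι → Prog S (Ty.denote S) .bool} {T : ι → Prop}
    (h : P.Decides c T) :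
    ∃ p : Polynomial ℕ, ∀ i, P.Valid i → ∀ b, p.eval (P.size i) ≤ b →
      (c i).eval.HaltsWithin b ∧ ∀ t : Bool, t ∈ (c i).eval.results b ↔ (t = true ↔ T i) :=
  h.imp fun _ hp i hi _ hb =>
    ⟨(hp i hi).haltsWithin hb, fun t => Set.ext_iff.1 ((hp i hi).results_eq hb) t⟩

/-- The inputs of the algorithms: an instance and a priority on it, listed. -/
def prioritizedInstances (F : List (DenialConstraint S)) :
    InputFamily (List (DBFact S) × List (DBFact S × DBFact S)) where
  Valid q := IsPriority F q.1.toFinset fun x y => (x, y) ∈ q.2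
  size q := inputSize q.1 q.2

theorem polyBounded_totalSize_instance :
    (prioritizedInstances F).PolyBounded fun q => totalSize q.1 :=
  polyBounded_size.of_le fun _ _ => Nat.le_add_right _ _

theorem polyBounded_size_priority :
    (prioritizedInstances F).PolyBounded fun q => (q.2.map fun x => x.1.size + x.2.size).sum :=
  polyBounded_size.of_le fun _ _ => Nat.le_add_left _ _

theorem decides_paretoOptimal_prioritizedInstances (F : List (DenialConstraint S)) :
    ((prioritizedInstances F).extend fun q (K : List (DBFact S)) =>
        K.Nodup ∧ K.toFinset ∈ Repairs F q.1.toFinset).Decides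
      (fun s => .isParetoOptimal F s.1.1 s.1.2 s.2) fun s =>
        ParetoOptimal F s.1.1.toFinset (fun x y => (x, y) ∈ s.1.2) s.2.toFinset :=
  have hI := polyBounded_totalSize_instance.extend _
  decides_paretoOptimal (P := (prioritizedInstances F).extend _) (fun _ hs => hs.1) hI
    (polyBounded_size_priority.extend _)
    (hI.of_le fun _ hs => totalSize_le_of_nodup hs.2.1 fun _ hx =>
      List.mem_toFinset.1 ((mem_repairs_iff.1 hs.2.2).1 (List.mem_toFinset.2 hx)))
    fun _ hs => hs.2.2

end InputFamily

open InputFamily in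
theorem mainTheorem12 (S : Schema) (F : List (DenialConstraint S)) :
    ∃ p : Polynomial ℕ, ∀ (I : DBInstance S) (r : DBFact S → DBFact S → Prop), IsPriority F I r →
      ∀ (inst : List (DBFact S)) (prio : List (DBFact S × DBFact S)),
        inst.toFinset = I → (∀ x y, (x, y) ∈ prio ↔ r x y) →
        ∀ b : ℕ, p.eval (inputSize inst prio) ≤ b →
          -- soundness, completeness and running time of the algorithm
          ProducesExactly (Prog.constructParetoOptimalRepair F inst prio) b (ParetoRepairs F I r) ∧
          -- its parts do what they are said to do: an arbitrary repair is constructed,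
          ProducesExactly (Prog.constructRepair F inst) b (Repairs F I) ∧
          -- a repair is tested for Pareto optimality,
          (∀ inst' : List (DBFact S), inst'.Nodup → inst'.toFinset ∈ Repairs F I →
            (Prog.isParetoOptimal F inst prio inst').eval.HaltsWithin b ∧
            ∀ t : Bool, t ∈ (Prog.isParetoOptimal F inst prio inst').eval.results b ↔
              (t = true ↔ ParetoOptimal F I r inst'.toFinset)) ∧
          -- and otherwise an arbitrary common optimal repair is constructed
          ProducesExactly (Prog.constructCommonOptimalRepair F inst prio) b (CommonRepairs F I r) := by
  have hI := polyBounded_totalSize_instance (F := F)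
  have hprio := polyBounded_size_priority (F := F)
  obtain ⟨p, hp⟩ :=
    (produces_constructParetoOptimalRepair (fun _ h => h) hI hprio).exists_polynomial
  obtain ⟨q, hq⟩ := (produces_constructRepair (F := F) hI).exists_polynomial
  obtain ⟨s, hs⟩ := (decides_paretoOptimal_prioritizedInstances F).exists_polynomial
  obtain ⟨t, ht⟩ :=
    (produces_constructCommonOptimalRepair (fun _ h => h) hI hprio).exists_polynomial
  refine ⟨p + q + s + t, fun I r hr inst prio hinst hmem b hb => ?_⟩
  obtain rfl : (fun x y => (x, y) ∈ prio) = r := funext₂ fun x y => propext (hmem x y)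
  subst hinst
  obtain ⟨hbp, hbq, hbs, hbt⟩ : p.eval (inputSize inst prio) ≤ b ∧
      q.eval (inputSize inst prio) ≤ b ∧ s.eval (inputSize inst prio) ≤ b ∧
      t.eval (inputSize inst prio) ≤ b := by
    simp only [Polynomial.eval_add] at hb
    omega
  exact ⟨hp (inst, prio) hr b hbp, hq (inst, prio) hr b hbq,
    fun K hnodup hK => hs ((inst, prio), K) ⟨hr, hnodup, hK⟩ b hbs, ht (inst, prio) hr b hbt⟩
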